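/- For every $n\ge 1$ let $c_n(x,y)$, $x,y\in\mathbb Z_n:=\{k/n: k\in\mathbb Z\}$, be the jump rates of a continuous-time nearest-neighbor random walk on $\mathbb Z_n$ ($c_n(x,y)>0$ if $|x-y|=1/n$, and $c_n(x,y)=0$ otherwise), and let $U_n,H_n:\mathbb Z_n\to(0,\infty)$ satisfy $c_n(x,y)=1/[H_n(x)\,U_n(x\vee y)]$ whenever $|x-y|=1/n$. Let $\mathbb L_n$ be the generator with Dirichlet conditions outside $(0,1)$, i.e. the operator on $\mathcal V_n=\{f:[0,1]\cap\mathbb Z_n\to\mathbb C,\ f(0)=f(1)=0\}$ with $\mathbb L_nf(x)=c_n(x,x-\tfrac1n)[f(x-\tfrac1n)-f(x)]+c_n(x,x+\tfrac1n)[f(x+\tfrac1n)-f(x)]$ for $x\in(0,1)\cap\mathbb Z_n$ and $\mathbb L_nf(0)=\mathbb L_nf(1)=0$. Put $x^{(n)}_k=\sum_{j=1}^kU_n(j/n)$ for $0\le k\le n$, $\ell_n=x^{(n)}_n$ and $dm_n=\sum_{k=0}^nH_n(k/n)\,\delta_{x_k^{(n)}}$. For a nondecreasing càdlàg function $m:\mathbb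 R\to[0,\infty)$ vanishing on $(-\infty,0)$, let $dm$ be its Lebesgue–Stieltjes measure and $E_m=\{x\ge0: m(x-\varepsilon)<m(x+\varepsilon)\ \forall\varepsilon>0\}$ its support. If $\inf E_m=0$ and $\ell_m:=\sup E_m\in(0,\infty)$, a function $F\in C([0,\ell_m],\mathbb C)$, $F\not\equiv0$, is an eigenfunction with eigenvalue $\lambda\in\mathbb C$ of $-D_mD_x$ with Dirichlet conditions outside $(0,\ell_m)$ if $F(0)=F(\ell_m)=0$ and, for some $b\in\mathbb C$, $$F(x)=bx-\lambda\int_0^xdy\int_{[0,y)}F(z)\,dm(z)\qquad\forall x\in[0,\ell_m].$$ The eigenvalue is called simple if its eigenspace is one-dimensional. The measure $dm_n$ is of this form, with $\ell_{m_n}=\ell_n$. **Theorem.** Suppose that $\ell_n\to\ell\in(0,\infty)$ and that $dm_n$ converges weakly to $dm$ (integrals of bounded continuous functions converge), where $m:\mathbb R\to[0,\infty)$ is nondecreasing and càdlàg, $m=0$ on $(-\infty,0)$, $\inf E_m=0$, $\sup E_m=\ell$, and $dm$ is not a linear combination of finitely many Dirac measures. Then: 1. The operator $-D_mD_x$ with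 Dirichlet conditions outside $(0,\ell)$ has infinitely many eigenvalues, all positive and simple; they can be listed in increasing order as $\lambda_1<\lambda_2<\cdots$. 2. For every $n\ge1$, $-\mathbb L_n$ has exactly $n-1$ eigenvalues $\lambda^{(n)}_1<\cdots<\lambda^{(n)}_{n-1}$, all positive and simple, and for each $k\ge1$, $\lim_{n\to\infty}\lambda_k^{(n)}=\lambda_k$. 3. For each $k\ge1$ and each eigenfunction $F_k$ of $-D_mD_x$ with Dirichlet conditions outside $(0,\ell)$ and eigenvalue $\lambda_k$, one can choose, for every $n>k$, an eigenfunction $F^{(n)}_k$ of $-D_{m_n}D_x$ with Dirichlet conditions outside $(0,\ell_n)$ and eigenvalue $\lambda_k^{(n)}$ such that $F_k^{(n)}\to F_k$ uniformly on $[0,\ell+1]$ as $n\to\infty$, where $F_k$ and $F_k^{(n)}$ are set equal to zero on $(\ell,\ell+1]$ and $(\ell_n,\ell+1]$, respectively. -/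

import Mathlib

open MeasureTheory Filter Topology

noncomputable section

/-- The points of increase of a nondecreasing càdlàg function `m` on `[0, ∞)`
(the support of `dm` when `m` vanishes on the negative half-line). -/
def growthSet (m : StieltjesFunction ℝ) : Set ℝ :=
  {x : ℝ | 0 ≤ x ∧ ∀ ε : ℝ, 0 < ε → m (x - ε) < m (x + ε)}

/-- `F` is an eigenfunction, with eigenvalue `z`, of the generalized differential operator
`-D_m D_x` with Dirichlet conditions outside `(0, ℓ)`, where `μ = dm`. Only the values of `F`
on `[0, ℓ]` are relevant. -/
def IsDirichletEigenfunction (μ : Measure ℝ) (ℓ : ℝ) (z : ℂ) (F : ℝ → ℂ) : Prop :=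
  ContinuousOn F (Set.Icc 0 ℓ) ∧ F 0 = 0 ∧ F ℓ = 0 ∧ (∃ x ∈ Set.Icc 0 ℓ, F x ≠ 0) ∧
    ∃ b : ℂ, ∀ x ∈ Set.Icc 0 ℓ,
      F x = b * (x : ℂ) - z * ∫ y in (0 : ℝ)..x, ∫ u in Set.Ico 0 y, F u ∂μ

/-- `z` is a Dirichlet eigenvalue of `-D_m D_x` on `(0, ℓ)`, where `μ = dm`. -/
def IsDirichletEigenvalue (μ : Measure ℝ) (ℓ : ℝ) (z : ℂ) : Prop :=
  ∃ F : ℝ → ℂ, IsDirichletEigenfunction μ ℓ z F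

/-- `z` is a simple Dirichlet eigenvalue: its eigenspace, a space of functions on `[0, ℓ]`,
is one-dimensional. -/
def IsSimpleDirichletEigenvalue (μ : Measure ℝ) (ℓ : ℝ) (z : ℂ) : Prop :=
  ∃ F : ℝ → ℂ, IsDirichletEigenfunction μ ℓ z F ∧
    ∀ G : ℝ → ℂ, IsDirichletEigenfunction μ ℓ z G →
      ∃ a : ℂ, ∀ x ∈ Set.Icc 0 ℓ, G x = a * F x

/-- Jump rates of a continuous-time nearest-neighbor random walk. The state space
`ℤ_n = {k / n : k ∈ ℤ}` is parametrized by `k ∈ ℤ` throughout. -/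
def IsNearestNeighborRate (c : ℤ → ℤ → ℝ) : Prop :=
  ∀ x y : ℤ, 0 ≤ c x y ∧ (0 < c x y ↔ |x - y| = 1)

/-- `U` and `H` are positive functions with `c(x, y) = 1 / (H(x) U(x ∨ y))` for all
neighbors `x, y`. -/
def IsScaleSpeedPair (c : ℤ → ℤ → ℝ) (U H : ℤ → ℝ) : Prop :=
  (∀ x, 0 < U x) ∧ (∀ x, 0 < H x) ∧
    ∀ x y : ℤ, |x - y| = 1 → c x y = 1 / (H x * U (max x y))

/-- The functions `f : [0,1] ∩ ℤ_n → ℂ` with `f(0) = f(1) = 0`; the point `k / n` is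
represented by `k ∈ {0, …, n}`. -/
def walkSpace (n : ℕ) : Submodule ℂ (Set.Icc (0 : ℤ) n → ℂ) where
  carrier := {f | f ⟨0, by simp⟩ = 0 ∧ f ⟨n, by simp⟩ = 0}
  add_mem' := by
    rintro f g ⟨hf, hf'⟩ ⟨hg, hg'⟩
    exact ⟨by simp [hf, hg], by simp [hf', hg']⟩
  zero_mem' := ⟨rfl, rfl⟩
  smul_mem' := by
    rintro a f ⟨hf, hf'⟩
    exact ⟨by simp [hf], by simp [hf']⟩

/-- The generator of the walk with rates `c`, with Dirichlet conditions outside `(0,1)`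
(outside `(0,n)` in the coordinate `k`). -/
def walkGenerator (c : ℤ → ℤ → ℝ) (n : ℕ) : Module.End ℂ (walkSpace n) where
  toFun f :=
    ⟨fun k =>
      if h : 0 < k.1 ∧ k.1 < n then
        (c k (k - 1) : ℂ) * (f.1 ⟨k.1 - 1, by constructor <;> omega⟩ - f.1 k) +
          (c k (k + 1) : ℂ) * (f.1 ⟨k.1 + 1, by constructor <;> omega⟩ - f.1 k)
      else 0,
      by constructor <;> simp⟩
  map_add' f g := by
    ext k
    by_cases h : 0 < k.1 ∧ k.1 < n
    · simp [h]; ring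
    · simp [h]
  map_smul' a f := by
    ext k
    by_cases h : 0 < k.1 ∧ k.1 < n
    · simp [h]; ring
    · simp [h]

/-- The point `S_n(k/n) = ∑_{j=1}^k U_n(j/n)`. -/
def scalePoint (U : ℤ → ℝ) (k : ℕ) : ℝ :=
  ∑ j ∈ Finset.Icc 1 k, U (j : ℤ)

/-- The measure `dm_n = ∑_{k=0}^n H_n(k/n) δ_{S_n(k/n)}`. -/
def speedMeasure (U H : ℤ → ℝ) (n : ℕ) : Measure ℝ :=
  ∑ k ∈ Finset.range (n + 1), ENNReal.ofReal (H (k : ℤ)) • Measure.dirac (scalePoint U k)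

end

/-! For a finite measure `μ` the initial value problem `F(0) = 0`, `F'(0) = 1` for `-D_μ D_x F = zF`
is a Volterra equation with kernel `(x - u)⁺`. Its solution `stringSol μ z` is a power series in
`-z` whose coefficients decay factorially, uniformly over measures of bounded mass. A Dirichlet
eigenfunction is a nonzero multiple of this solution, so eigenvalues are the zeros of `z ↦ stringSol
μ z ℓ` and are simple (`isDirichletEigenfunction_iff`). For the atomic measures `dm_n` the solution,
sampled at the atoms, obeys the difference equation of the walk, so the eigenvalues of the walk are
zeros of the same kind (`hasEigenvalue_walkGenerator_iff`).

Green's identity (`stringSol_green`) supplies the spectral facts: zeros are real and positive,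
solutions at distinct zeros are orthogonal in `L²(μ)`, zeros are isolated, and the characteristic
function changes sign at each of them. Weak convergence of the measures makes the solutions converge
locally uniformly (`WeakTendsto.stringSol`). Hence limits of discrete eigenvalues are eigenvalues of
the limit, each eigenvalue of the limit is approached by discrete ones, and two discrete eigenvalues
cannot merge, since their orthogonal eigenfunctions would have a common nonzero limit.

It remains to see that the `k`-th discrete eigenvalue stays bounded in `n`. This is a min-max
estimate for a Jacobi matrix (`exists_discrete_spectrum`): as `dm` is not a finite sum of atoms,
there are `k` disjointly supported hat functions with controlled energy and with norms bounded below
(`exists_bound_card_le`). A compactness argument on ordered lists (`exists_limit_enumeration`) then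
gives the convergence, and with it the infinitude of the limit spectrum. -/

/-! ### The Volterra operator with kernel `(x - u)⁺`. -/

section Volterra

variable {E : Type*} [NormedAddCommGroup E] [NormedSpace ℝ E]

/-- The Volterra operator `f ↦ ∫ (x - u)⁺ f(u) dμ(u)`. -/
noncomputable def volterra (μ : Measure ℝ) (f : ℝ → E) (x : ℝ) : E :=
  ∫ u, max (x - u) 0 • f u ∂μ

/-- The kernel cuts the integrand off above `x` and the vanishing of `f` cuts it off below `0`, so
it is continuous with compact support; nothing is asked of the support of `μ`. -/
lemma integrable_volterra (μ : Measure ℝ) [IsFiniteMeasure μ] {f : ℝ → E} (hf : Continuous f)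
    (hf0 : ∀ u ≤ 0, f u = 0) (x : ℝ) : Integrable (fun u => max (x - u) 0 • f u) μ := by
  refine Continuous.integrable_of_hasCompactSupport (by fun_prop)
    (HasCompactSupport.intro (isCompact_Icc (a := 0) (b := x)) fun u hu => ?_)
  rcases le_total u 0 with h | h
  · simp [hf0 u h]
  · have : x < u := not_le.1 fun h' => hu ⟨h, h'⟩
    simp [max_eq_right (by linarith : x - u ≤ 0)]

/-- The kernel is 1-Lipschitz in its first variable. The constant involves `μ` only through its
mass, which later makes families of solutions equi-Lipschitz. -/
lemma norm_volterra_sub_le (μ : Measure ℝ) [IsFiniteMeasure μ] {f : ℝ → E} (hf : Continuous f)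
    (hf0 : ∀ u ≤ 0, f u = 0) {R B : ℝ} (hB0 : 0 ≤ B) (hB : ∀ u ≤ R, ‖f u‖ ≤ B) {x y : ℝ}
    (hx : x ≤ R) (hy : y ≤ R) :
    ‖volterra μ f x - volterra μ f y‖ ≤ B * μ.real Set.univ * |x - y| := by
  unfold volterra
  rw [← integral_sub (integrable_volterra μ hf hf0 x) (integrable_volterra μ hf hf0 y)]
  have : ∀ u, ‖max (x - u) 0 • f u - max (y - u) 0 • f u‖ ≤ |x - y| * B := by
    intro u
    rw [← sub_smul, norm_smul, Real.norm_eq_abs]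
    rcases le_total u R with h | h
    · have h1 := abs_max_sub_max_le_abs (x - u) (y - u) 0
      rw [sub_sub_sub_cancel_right] at h1
      exact mul_le_mul h1 (hB u h) (norm_nonneg _) (abs_nonneg _)
    · rw [max_eq_right (by linarith), max_eq_right (by linarith)]
      simp only [sub_self, abs_zero, zero_mul]
      positivity
  refine (norm_integral_le_of_norm_le_const (.of_forall this)).trans (le_of_eq (by ring))

omit [NormedSpace ℝ E] in
lemma continuous_of_lipschitz_Iic {f : ℝ → E}
    (h : ∀ R, ∃ C, ∀ x ≤ R, ∀ y ≤ R, ‖f x - f y‖ ≤ C * |x - y|) : Continuous f := by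
  refine continuous_iff_continuousAt.2 fun x => ?_
  obtain ⟨C, hC⟩ := h (x + 1)
  rw [ContinuousAt, tendsto_iff_norm_sub_tendsto_zero]
  refine squeeze_zero' (.of_forall fun _ => norm_nonneg _) (g := fun y => C * |y - x|) ?_ ?_
  · filter_upwards [Iio_mem_nhds (lt_add_one x)] with y hy
    exact hC y (le_of_lt hy) x (by linarith)
  · have : Continuous fun y => C * |y - x| := by fun_prop
    simpa using this.tendsto x

end Volterra

/-! ### The initial value problem as a power series in the spectral parameter. -/

/-- The power series coefficients, in `-z`, of the solution of `-D_μ D_x F = z F` with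
`F 0 = 0`, `F' 0 = 1`. -/
noncomputable def stringCoeff (μ : Measure ℝ) : ℕ → ℝ → ℝ
  | 0 => fun x => max x 0
  | j + 1 => volterra μ (stringCoeff μ j)

lemma sub_mul_pow_le {x u : ℝ} (hu : 0 ≤ u) (hux : u ≤ x) (n : ℕ) :
    (x - u) * u ^ n ≤ x ^ (n + 1) / (n + 1) := by
  have hn : (0 : ℝ) < n + 1 := by positivity
  rw [le_div_iff₀ hn]
  -- The graph of the convex function `u ↦ u ^ (n + 1)` lies above its tangent at `u`.
  have h : u ^ (n + 1) + (n + 1) * u ^ n * (x - u) ≤ x ^ (n + 1) := by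
    induction n with
    | zero => simp
    | succ n ih =>
      have ih := mul_le_mul_of_nonneg_right (ih (by positivity)) (hu.trans hux)
      have h1 : 0 ≤ (n + 1) * u ^ n * (x - u) ^ 2 := by positivity
      push_cast
      rw [pow_succ x (n + 1)]
      have h2 : (u ^ (n + 1) + ((n : ℝ) + 1) * u ^ n * (x - u)) * x -
          (u ^ (n + 1 + 1) + ((n : ℝ) + 1 + 1) * u ^ (n + 1) * (x - u)) =
          (n + 1) * u ^ n * (x - u) ^ 2 := by ring
      linarith
  nlinarith [pow_nonneg hu (n + 1)]

section

variable (μ : Measure ℝ) [IsFiniteMeasure μ]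

/-- Continuity and the bound go through one induction, because the Lipschitz estimate for the next
coefficient needs the bound on the current one. Since `μ` is arbitrary, the integral is bounded by
supremum times mass; the factor `1 / (j + 1)` comes from `sub_mul_pow_le`, applied to all but one
power of `u`, and that last power is bounded by `x`. -/
lemma stringCoeff_aux (j : ℕ) : Continuous (stringCoeff μ j) ∧ ∀ x, 0 ≤ stringCoeff μ j x ∧
    stringCoeff μ j x ≤ max x 0 * ((μ.real Set.univ * max x 0) ^ j / j.factorial) := by
  induction j with
  | zero => exact ⟨by simp only [stringCoeff]; fun_prop, by simp [stringCoeff]⟩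
  | succ j ih =>
    obtain ⟨hc, hb⟩ := ih
    have h0 : ∀ u ≤ 0, stringCoeff μ j u = 0 := fun u hu =>
      le_antisymm (by simpa [max_eq_right hu] using (hb u).2) (hb u).1
    refine ⟨continuous_of_lipschitz_Iic fun R => ⟨_, fun x hx y hy =>
      norm_volterra_sub_le μ hc h0 (R := R)
        (B := max R 0 * ((μ.real Set.univ * max R 0) ^ j / j.factorial))
        (by positivity) (fun u hu => ?_) hx hy⟩, fun x => ⟨?_, ?_⟩⟩
    · rw [Real.norm_eq_abs, abs_of_nonneg (hb u).1]
      refine (hb u).2.trans ?_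
      have : max u 0 ≤ max R 0 := max_le_max hu le_rfl
      gcongr
    · exact integral_nonneg fun u => mul_nonneg (le_max_right _ _) (hb u).1
    · refine ((le_abs_self _).trans (norm_integral_le_of_norm_le_const (μ := μ)
        (f := fun u => max (x - u) 0 • stringCoeff μ j u) (C := max x 0 * (μ.real Set.univ ^ j * max x 0 ^ (j + 1) / (j + 1).factorial))
        (.of_forall fun u => ?_))).trans (le_of_eq (by rw [mul_pow]; ring))
      rw [smul_eq_mul, Real.norm_eq_abs,
        abs_of_nonneg (mul_nonneg (le_max_right _ _) (hb u).1)]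
      rcases le_total u 0 with hu | hu
      · rw [h0 u hu, mul_zero]; positivity
      rcases le_total x u with hxu | hxu
      · rw [max_eq_right (sub_nonpos.2 hxu), zero_mul]; positivity
      have h2 := (hb u).2
      rw [max_eq_left hu] at h2
      rw [max_eq_left (sub_nonneg.2 hxu), max_eq_left (hu.trans hxu)]
      have hx := hu.trans hxu
      calc (x - u) * stringCoeff μ j u
          ≤ (x - u) * (u * ((μ.real Set.univ * u) ^ j / j.factorial)) :=
            mul_le_mul_of_nonneg_left h2 (sub_nonneg.2 hxu)
        _ = u * (μ.real Set.univ ^ j * ((x - u) * u ^ j) / j.factorial) := by ring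
        _ ≤ x * (μ.real Set.univ ^ j * (x ^ (j + 1) / (j + 1)) / j.factorial) := by
            have := sub_mul_pow_le hu hxu j
            gcongr
        _ = _ := by
            rw [Nat.factorial_succ]; push_cast
            field_simp

lemma continuous_stringCoeff (j : ℕ) : Continuous (stringCoeff μ j) := (stringCoeff_aux μ j).1

lemma stringCoeff_nonneg (j : ℕ) (x : ℝ) : 0 ≤ stringCoeff μ j x := ((stringCoeff_aux μ j).2 x).1

lemma stringCoeff_of_nonpos (j : ℕ) {x : ℝ} (hx : x ≤ 0) : stringCoeff μ j x = 0 :=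
  le_antisymm (by simpa [max_eq_right hx] using ((stringCoeff_aux μ j).2 x).2)
    (stringCoeff_nonneg μ j x)

lemma stringCoeff_le (j : ℕ) {x R M : ℝ} (hR : 0 ≤ R) (hx : x ≤ R) (hM : μ.real Set.univ ≤ M) :
    stringCoeff μ j x ≤ R * ((M * R) ^ j / j.factorial) := by
  refine ((stringCoeff_aux μ j).2 x).2.trans ?_
  have : max x 0 ≤ R := max_le hx hR
  have := measureReal_nonneg.trans hM
  gcongr

end

/-- The solution of `-D_μ D_x F = z F` with `F 0 = 0`, `F' 0 = 1`. -/
noncomputable def stringSol (μ : Measure ℝ) (z : ℂ) (x : ℝ) : ℂ :=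
  ∑' j : ℕ, (-z) ^ j * (stringCoeff μ j x : ℂ)

section

variable (μ : Measure ℝ) [IsFiniteMeasure μ] (z : ℂ)

lemma norm_stringSol_term_le (j : ℕ) {x R M C : ℝ} (hR : 0 ≤ R) (hx : x ≤ R)
    (hM : μ.real Set.univ ≤ M) (hC : ‖z‖ ≤ C) :
    ‖(-z) ^ j * (stringCoeff μ j x : ℂ)‖ ≤ R * ((C * M * R) ^ j / j.factorial) := by
  rw [norm_mul, norm_pow, norm_neg, Complex.norm_real, Real.norm_eq_abs,
    abs_of_nonneg (stringCoeff_nonneg μ j x)]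
  calc ‖z‖ ^ j * stringCoeff μ j x ≤ C ^ j * (R * ((M * R) ^ j / j.factorial)) := by
        have := stringCoeff_le μ j hR hx hM
        have := stringCoeff_nonneg μ j x
        have := (norm_nonneg z).trans hC
        gcongr
    _ = _ := by ring

lemma summable_expBound (R c : ℝ) : Summable fun j : ℕ => R * (c ^ j / j.factorial) :=
  (Real.summable_pow_div_factorial c).mul_left R

lemma tsum_expBound (R c : ℝ) : ∑' j : ℕ, R * (c ^ j / j.factorial) = R * Real.exp c := by
  rw [tsum_mul_left, Real.exp_eq_exp_ℝ, NormedSpace.exp_eq_tsum_div]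

lemma summable_stringSol (x : ℝ) : Summable fun j => (-z) ^ j * (stringCoeff μ j x : ℂ) :=
  Summable.of_norm_bounded (summable_expBound (max x 0) _) fun j =>
    norm_stringSol_term_le μ z j (le_max_right x 0) (le_max_left x 0) le_rfl le_rfl

lemma norm_stringSol_le {x R M C : ℝ} (hR : 0 ≤ R) (hx : x ≤ R) (hM : μ.real Set.univ ≤ M)
    (hC : ‖z‖ ≤ C) : ‖stringSol μ z x‖ ≤ R * Real.exp (C * M * R) := by
  rw [← tsum_expBound]
  exact tsum_of_norm_bounded (summable_expBound _ _).hasSum fun j =>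
    norm_stringSol_term_le μ z j hR hx hM hC

lemma continuous_stringSol : Continuous (stringSol μ z) := by
  refine continuous_iff_continuousAt.2 fun x => ?_
  refine ContinuousOn.continuousAt (s := Set.Iic (|x| + 1)) ?_
    (Iic_mem_nhds (lt_of_le_of_lt (le_abs_self x) (lt_add_one _)))
  exact continuousOn_tsum (fun j => ((continuous_const.mul
    (Complex.continuous_ofReal.comp (continuous_stringCoeff μ j))).continuousOn))
    (summable_expBound (|x| + 1) _) fun j y hy =>
      norm_stringSol_term_le μ z j (by positivity) hy le_rfl le_rfl

lemma stringSol_of_nonpos {x : ℝ} (hx : x ≤ 0) : stringSol μ z x = 0 := by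
  simp [stringSol, stringCoeff_of_nonpos μ _ hx]

/-- Termwise, the Volterra operator raises the index of a coefficient by one; the factorial bounds
allow the sum and the integral to be exchanged. -/
lemma stringSol_eq (x : ℝ) :
    stringSol μ z x = (max x 0 : ℝ) - z * volterra μ (stringSol μ z) x := by
  have hint : ∀ j, Integrable
      (fun u => max (x - u) 0 • ((-z) ^ j * (stringCoeff μ j u : ℂ))) μ := fun j =>
    integrable_volterra μ (continuous_const.mul
      (Complex.continuous_ofReal.comp (continuous_stringCoeff μ j)))
      (fun u hu => by simp [stringCoeff_of_nonpos μ j hu]) x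
  have hswap := hasSum_integral_of_summable_integral_norm hint (by
    refine Summable.of_nonneg_of_le (fun j => integral_nonneg fun u => norm_nonneg _)
      (fun j => ?_) ((summable_expBound (|x| * |x|) (‖z‖ * μ.real Set.univ * |x|)).mul_right
        (μ.real Set.univ))
    refine (le_abs_self _).trans (norm_integral_le_of_norm_le_const
      (f := fun u => ‖max (x - u) 0 • ((-z) ^ j * (stringCoeff μ j u : ℂ))‖)
      (.of_forall fun u => ?_))
    rw [norm_norm, norm_smul, Real.norm_eq_abs, abs_of_nonneg (le_max_right _ _)]
    rcases le_total u 0 with hu | hu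
    · simp only [stringCoeff_of_nonpos μ j hu, Complex.ofReal_zero, mul_zero, norm_zero]
      positivity
    rcases le_total x u with hxu | hxu
    · simp only [max_eq_right (sub_nonpos.2 hxu), zero_mul]; positivity
    · rw [mul_assoc]
      refine mul_le_mul (max_le ((sub_le_self _ hu).trans (le_abs_self x)) (abs_nonneg x))
        (norm_stringSol_term_le μ z j (abs_nonneg x) (hxu.trans (le_abs_self x)) le_rfl le_rfl)
        (norm_nonneg _) (abs_nonneg x))
  have hsum : HasSum (fun j => (-z) ^ j * (stringCoeff μ (j + 1) x : ℂ))
      (volterra μ (stringSol μ z) x) := by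
    have e1 : ∀ j, (-z) ^ j * (stringCoeff μ (j + 1) x : ℂ) =
        ∫ u, max (x - u) 0 • ((-z) ^ j * (stringCoeff μ j u : ℂ)) ∂μ := by
      intro j
      change _ * ((∫ u, max (x - u) 0 • stringCoeff μ j u ∂μ : ℝ) : ℂ) = _
      rw [← integral_complex_ofReal, ← integral_const_mul]
      congr 1; ext u
      simp only [smul_eq_mul, Complex.ofReal_mul, Complex.real_smul]; ring
    have e2 : volterra μ (stringSol μ z) x =
        ∫ u, ∑' j, max (x - u) 0 • ((-z) ^ j * (stringCoeff μ j u : ℂ)) ∂μ := by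
      unfold volterra stringSol
      congr 1; ext u
      rw [tsum_const_smul'']
    simpa only [e1, e2] using hswap
  rw [stringSol, (summable_stringSol μ z x).tsum_eq_zero_add, ← hsum.tsum_eq, ← tsum_mul_left]
  simp only [pow_zero, one_mul, stringCoeff, sub_eq_add_neg, ← tsum_neg]
  congr 1
  refine tsum_congr fun j => ?_
  rw [pow_succ]; ring

lemma norm_stringSol_sub_le {x y R M C : ℝ} (hR : 0 ≤ R) (hx : x ≤ R) (hy : y ≤ R)
    (hM : μ.real Set.univ ≤ M) (hC : ‖z‖ ≤ C) :
    ‖stringSol μ z x - stringSol μ z y‖ ≤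
      (1 + C * (R * Real.exp (C * M * R) * M)) * |x - y| := by
  rw [stringSol_eq, stringSol_eq μ z y]
  have h1 := norm_volterra_sub_le μ (continuous_stringSol μ z)
    (fun u hu => stringSol_of_nonpos μ z hu) (B := R * Real.exp (C * M * R)) (by positivity)
    (fun u hu => norm_stringSol_le μ z hR hu hM hC) hx hy
  have h2 : ‖((max x 0 : ℝ) : ℂ) - (max y 0 : ℝ)‖ ≤ |x - y| := by
    rw [← Complex.ofReal_sub, Complex.norm_real]
    exact abs_max_sub_max_le_abs x y 0
  have hC0 : 0 ≤ C := (norm_nonneg z).trans hC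
  calc _ = ‖(((max x 0 : ℝ) : ℂ) - (max y 0 : ℝ)) -
        z * (volterra μ (stringSol μ z) x - volterra μ (stringSol μ z) y)‖ := by
          congr 1; ring
    _ ≤ |x - y| + C * (R * Real.exp (C * M * R) * M * |x - y|) := by
      refine (norm_sub_le _ _).trans (add_le_add h2 ?_)
      rw [norm_mul]
      refine mul_le_mul hC (h1.trans ?_) (norm_nonneg _) hC0
      gcongr
    _ = _ := by ring

omit [IsFiniteMeasure μ] in
lemma stringSol_conj (x : ℝ) :
    stringSol μ (starRingEnd ℂ z) x = starRingEnd ℂ (stringSol μ z x) := by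
  simp only [stringSol, Complex.conj_tsum, map_mul, map_pow, map_neg, Complex.conj_ofReal]

omit [IsFiniteMeasure μ] in
lemma stringSol_ofReal_re (t x : ℝ) : ((stringSol μ t x).re : ℂ) = stringSol μ t x := by
  rw [← Complex.conj_eq_iff_re, ← stringSol_conj, Complex.conj_ofReal]

/-- For `t ≤ 0` every term of the series is nonnegative and the zeroth one is `x`. This rules out
nonpositive eigenvalues. -/
lemma le_stringSol_of_nonpos {t x : ℝ} (ht : t ≤ 0) (hx : 0 ≤ x) : x ≤ (stringSol μ t x).re := by
  have h : HasSum (fun j => (-t) ^ j * stringCoeff μ j x) (stringSol μ t x).re := by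
    convert! Complex.hasSum_re (summable_stringSol μ t x).hasSum using 1
    ext j
    rw [← Complex.ofReal_neg, ← Complex.ofReal_pow, ← Complex.ofReal_mul, Complex.ofReal_re]
  have := le_hasSum h 0 fun j _ =>
    mul_nonneg (pow_nonneg (neg_nonneg.2 ht) j) (stringCoeff_nonneg μ j x)
  simpa [stringCoeff, max_eq_left hx] using this

end

/-! ### Dirichlet eigenfunctions, uniqueness and Green's identity. -/

section

variable (μ : Measure ℝ) [IsFiniteMeasure μ]

omit [IsFiniteMeasure μ] in
lemma volterra_congr {f g : ℝ → ℂ} {x : ℝ} (h : ∀ u ≤ x, f u = g u) :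
    volterra μ f x = volterra μ g x := by
  unfold volterra
  congr 1; ext u
  rcases le_total u x with hu | hu
  · rw [h u hu]
  · simp [max_eq_right (sub_nonpos.2 hu)]

lemma volterra_sub_smul {f g : ℝ → ℂ} (hf : Continuous f) (hf0 : ∀ u ≤ 0, f u = 0)
    (hg : Continuous g) (hg0 : ∀ u ≤ 0, g u = 0) (b : ℂ) (x : ℝ) :
    volterra μ (fun u => f u - b * g u) x = volterra μ f x - b * volterra μ g x := by
  unfold volterra
  rw [← integral_const_mul, ← integral_sub (integrable_volterra μ hf hf0 x)
    ((integrable_volterra μ hg hg0 x).const_mul b)]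
  congr 1; ext u
  simp only [Complex.real_smul]; ring

/-- Iterated integration as a single integral against the Volterra kernel. -/
lemma intervalIntegral_integral_Ico {f : ℝ → ℂ} (hf : Continuous f) (hf0 : ∀ u ≤ 0, f u = 0)
    {B : ℝ} (hB : ∀ u, ‖f u‖ ≤ B) {x : ℝ} (hx : 0 ≤ x) :
    ∫ y in (0 : ℝ)..x, ∫ u in Set.Ico 0 y, f u ∂μ = volterra μ f x := by
  have h1 : ∀ y, ∫ u in Set.Ico 0 y, f u ∂μ = ∫ u, (Set.Iio y).indicator f u ∂μ := by
    intro y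
    rw [← integral_indicator measurableSet_Ico]
    congr 1; ext u
    rcases le_total u 0 with hu | hu
    · simp [Set.indicator, hf0 u hu]
    · simp [Set.indicator, hu]
  simp_rw [h1]
  rw [intervalIntegral.integral_of_le hx, integral_integral_swap]
  · unfold volterra
    congr 1; ext u
    rcases le_total u 0 with hu | hu
    · simp [Set.indicator, hf0 u hu]
    have h2 : (fun y => (Set.Iio y).indicator f u) = (Set.Ioi u).indicator fun _ => f u := by
      ext y; simp [Set.indicator]
    rw [h2, integral_indicator measurableSet_Ioi, setIntegral_const, measureReal_restrict_apply
      measurableSet_Ioi, Set.inter_comm, Set.Ioc_inter_Ioi, max_eq_right hu,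
      Real.volume_real_Ioc]
  · have hm : Measurable (Function.uncurry fun (y u : ℝ) => (Set.Iio y).indicator f u) := by
      have : (Function.uncurry fun (y u : ℝ) => (Set.Iio y).indicator f u) =
          {p : ℝ × ℝ | p.2 < p.1}.indicator fun p => f p.2 := by
        ext ⟨y, u⟩; simp [Set.indicator]
      rw [this]
      exact (hf.measurable.comp measurable_snd).indicator
        (measurableSet_lt measurable_snd measurable_fst)
    refine Integrable.of_bound hm.aestronglyMeasurable B (.of_forall fun p => ?_)
    exact (norm_indicator_le_norm_self _ _).trans (hB _)

/-- Iterating the homogeneous equation `j` times bounds `f` by a multiple of `(c x) ^ j / j!`, which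
tends to zero; no smallness of `z` is needed. -/
lemma eq_zero_of_volterra {f : ℝ → ℂ} (hf : Continuous f) (hf0 : ∀ u ≤ 0, f u = 0) {z : ℂ}
    {ℓ : ℝ} (h : ∀ x, 0 ≤ x → x ≤ ℓ → f x = -z * volterra μ f x) {x : ℝ} (hx : x ≤ ℓ) :
    f x = 0 := by
  rcases le_total x 0 with hx0 | hx0
  · exact hf0 x hx0
  obtain ⟨K, hK⟩ := (isCompact_Icc (a := 0) (b := ℓ)).exists_bound_of_continuousOn hf.continuousOn
  set c := ‖z‖ * μ.real Set.univ with hc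
  have key : ∀ j : ℕ, ∀ x, 0 ≤ x → x ≤ ℓ → ‖f x‖ ≤ K * ((c * x) ^ j / j.factorial) := by
    intro j
    induction j with
    | zero => intro x h0 h1; simpa using hK x ⟨h0, h1⟩
    | succ j ih =>
      intro x h0 h1
      have hK0 : 0 ≤ K := (norm_nonneg _).trans (hK x ⟨h0, h1⟩)
      have hc0 : 0 ≤ c := by positivity
      rw [h x h0 h1, norm_mul, norm_neg]
      have : ‖volterra μ f x‖ ≤
          (K * (c ^ j * (x ^ (j + 1) / (j + 1)) / j.factorial)) * μ.real Set.univ := by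
        refine norm_integral_le_of_norm_le_const (.of_forall fun u => ?_)
        rw [norm_smul, Real.norm_eq_abs, abs_of_nonneg (le_max_right _ _)]
        rcases le_total u 0 with hu | hu
        · rw [hf0 u hu, norm_zero, mul_zero]; positivity
        rcases le_total x u with hxu | hxu
        · rw [max_eq_right (sub_nonpos.2 hxu), zero_mul]; positivity
        rw [max_eq_left (sub_nonneg.2 hxu)]
        calc (x - u) * ‖f u‖ ≤ (x - u) * (K * ((c * u) ^ j / j.factorial)) :=
              mul_le_mul_of_nonneg_left (ih u hu (hxu.trans h1)) (sub_nonneg.2 hxu)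
          _ = K * (c ^ j * ((x - u) * u ^ j) / j.factorial) := by ring
          _ ≤ _ := by
              have := sub_mul_pow_le hu hxu j
              gcongr
      calc ‖z‖ * ‖volterra μ f x‖ ≤ ‖z‖ * _ := mul_le_mul_of_nonneg_left this (norm_nonneg _)
        _ = K * ((c * x) ^ (j + 1) / (j + 1).factorial) := by
            rw [Nat.factorial_succ, hc]; push_cast
            field_simp
            ring
  have hlim : Tendsto (fun j : ℕ => K * ((c * x) ^ j / j.factorial)) atTop (𝓝 (K * 0)) :=
    (FloorSemiring.tendsto_pow_div_factorial_atTop (c * x)).const_mul K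
  rw [mul_zero] at hlim
  exact norm_le_zero_iff.1 (ge_of_tendsto' hlim fun j => key j x hx0 hx)

/-- Used for nontriviality: a solution that vanishes `μ`-almost everywhere is the identity on `x ≥
0`, and so is nonzero at `ℓ`. -/
lemma stringSol_eq_self_of_eq_zero {z : ℂ} {x : ℝ} (hx : 0 ≤ x)
    (h : volterra μ (stringSol μ z) x = 0) : stringSol μ z x = x := by
  rw [stringSol_eq, h, mul_zero, sub_zero, max_eq_left hx]

/-- The Dirichlet eigenfunctions are the multiples of the solution of the initial value problem
when this vanishes at the right end. -/
theorem isDirichletEigenfunction_iff {ℓ : ℝ} (hℓ : 0 < ℓ) (z : ℂ) (F : ℝ → ℂ) :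
    IsDirichletEigenfunction μ ℓ z F ↔ stringSol μ z ℓ = 0 ∧
      ∃ b : ℂ, b ≠ 0 ∧ ∀ x ∈ Set.Icc 0 ℓ, F x = b * stringSol μ z x := by
  have hφ := continuous_stringSol μ z
  have hφ0 : ∀ u ≤ 0, stringSol μ z u = 0 := fun u hu => stringSol_of_nonpos μ z hu
  -- the iterated integral of a function on `[0, ℓ]`
  have iter : ∀ {F : ℝ → ℂ}, ContinuousOn F (Set.Icc 0 ℓ) → F 0 = 0 → ∀ {x}, x ∈ Set.Icc 0 ℓ →
      ∫ y in (0 : ℝ)..x, ∫ u in Set.Ico 0 y, F u ∂μ =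
        volterra μ (fun u => F (max 0 (min ℓ u))) x := by
    intro F hF hF0 x hx
    obtain ⟨B, hB⟩ := isCompact_Icc.exists_bound_of_continuousOn hF
    have hmem : ∀ u, max 0 (min ℓ u) ∈ Set.Icc 0 ℓ := fun u =>
      ⟨le_max_left _ _, max_le hℓ.le (min_le_left _ _)⟩
    rw [← intervalIntegral_integral_Ico μ (f := fun u => F (max 0 (min ℓ u))) (hF.comp_continuous (by fun_prop) hmem)
      (fun u hu => by simp [max_eq_left ((min_le_right ℓ u).trans hu), hF0])
      (fun u => hB _ (hmem u)) hx.1]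
    refine intervalIntegral.integral_congr fun y hy => ?_
    rw [Set.uIcc_of_le hx.1] at hy
    refine setIntegral_congr_fun measurableSet_Ico fun u hu => ?_
    rw [min_eq_right (hu.2.le.trans (hy.2.trans hx.2)), max_eq_right hu.1]
  constructor
  · rintro ⟨hF, hF0, hFℓ, ⟨x₀, hx₀, hne⟩, b, hb⟩
    have heq : ∀ x ∈ Set.Icc 0 ℓ, F x = b * stringSol μ z x := by
      -- Only the values of `F` on `[0, ℓ]` are meaningful; composing with the projection onto this
      -- interval gives a function continuous on the line to which the uniqueness lemma applies.
      set G : ℝ → ℂ := fun u => F (max 0 (min ℓ u)) with hG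
      have hGF : ∀ x ∈ Set.Icc 0 ℓ, G x = F x := fun x hx => by
        simp only [hG, min_eq_right hx.2, max_eq_right hx.1]
      have hGc : Continuous G := hF.comp_continuous (by fun_prop) fun u =>
        ⟨le_max_left _ _, max_le hℓ.le (min_le_left _ _)⟩
      have hG0 : ∀ u ≤ 0, G u = 0 := fun u hu => by
        simp [hG, max_eq_left ((min_le_right ℓ u).trans hu), hF0]
      intro x hx
      rw [← hGF x hx]
      refine sub_eq_zero.1 (eq_zero_of_volterra μ (f := fun u => G u - b * stringSol μ z u) (z := z)
        (ℓ := ℓ) (by fun_prop) (fun u hu => by simp [hG0 u hu, hφ0 u hu]) (fun y h0 h1 => ?_) hx.2)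
      rw [volterra_sub_smul μ hGc hG0 hφ hφ0, hGF y ⟨h0, h1⟩, hb y ⟨h0, h1⟩,
        iter hF hF0 ⟨h0, h1⟩, stringSol_eq, max_eq_left h0]
      ring
    have hb0 : b ≠ 0 := by
      rintro rfl
      exact hne (by rw [heq x₀ hx₀, zero_mul])
    refine ⟨?_, b, hb0, heq⟩
    have := heq ℓ ⟨hℓ.le, le_rfl⟩
    rw [hFℓ] at this
    exact (mul_eq_zero.1 this.symm).resolve_left hb0
  · rintro ⟨h0, b, hb, hF⟩
    have hFc : ContinuousOn F (Set.Icc 0 ℓ) :=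
      ContinuousOn.congr (continuous_const.mul hφ).continuousOn hF
    have hF0 : F 0 = 0 := by rw [hF 0 ⟨le_rfl, hℓ.le⟩, hφ0 0 le_rfl, mul_zero]
    refine ⟨hFc, hF0, by rw [hF ℓ ⟨hℓ.le, le_rfl⟩, h0, mul_zero], ?_, b, fun x hx => ?_⟩
    · by_contra! hcon
      have : stringSol μ z ℓ = ℓ := by
        refine stringSol_eq_self_of_eq_zero μ hℓ.le ?_
        rw [volterra_congr μ (g := fun _ => 0)]
        · simp [volterra]
        · intro u hu
          rcases le_total u 0 with hu0 | hu0
          · exact hφ0 u hu0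
          · exact (mul_eq_zero.1 ((hF u ⟨hu0, hu⟩).symm.trans (hcon u ⟨hu0, hu⟩))).resolve_left hb
      rw [h0] at this
      exact hℓ.ne' (Complex.ofReal_eq_zero.1 this.symm)
    · rw [iter hFc hF0 hx, hF x hx, stringSol_eq, max_eq_left hx.1]
      have : volterra μ (fun u => F (max 0 (min ℓ u))) x = b * volterra μ (stringSol μ z) x := by
        unfold volterra
        rw [← integral_const_mul]
        congr 1; ext u
        rcases le_total u 0 with hu0 | hu0
        · simp [hφ0 u hu0, max_eq_left ((min_le_right ℓ u).trans hu0), hF0]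
        rcases le_total u x with hu | hu
        · simp only
          rw [min_eq_right (hu.trans hx.2), max_eq_right hu0, hF u ⟨hu0, hu.trans hx.2⟩]
          simp only [Complex.real_smul]; ring
        · simp [max_eq_right (sub_nonpos.2 hu)]
      rw [this]; ring

lemma integrable_of_continuous {μ : Measure ℝ} [IsFiniteMeasure μ] {ℓ : ℝ}
    (hμ : μ (Set.Icc 0 ℓ)ᶜ = 0) {f : ℝ → ℂ} (hf : Continuous f) : Integrable f μ := by
  rw [← Measure.restrict_eq_self_of_ae_mem (s := Set.Icc 0 ℓ) (μ := μ) (by exact hμ)]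
  exact hf.continuousOn.integrableOn_compact isCompact_Icc

/-- Green's identity for two solutions, one of which vanishes at the right end. -/
theorem stringSol_green {μ : Measure ℝ} [IsFiniteMeasure μ] {ℓ : ℝ} (hℓ : 0 < ℓ)
    (hμ : μ (Set.Icc 0 ℓ)ᶜ = 0) (a : ℂ) {b : ℂ} (hb : stringSol μ b ℓ = 0) :
    (a - b) * ∫ x, stringSol μ a x * stringSol μ b x ∂μ =
      -(stringSol μ a ℓ / ℓ) * b * ∫ x, x * stringSol μ b x ∂μ := by
  set A := stringSol μ a with hA
  set B := stringSol μ b with hB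
  have hAc : Continuous A := continuous_stringSol μ a
  have hBc : Continuous B := continuous_stringSol μ b
  have hℓ' : (ℓ : ℂ) ≠ 0 := Complex.ofReal_ne_zero.2 hℓ.ne'
  -- On `[0, ℓ]` this is the Green function `min x u * (ℓ - max x u) / ℓ` of `-d²/dx²` with
  -- Dirichlet conditions, hence symmetric.
  set g : ℝ → ℝ → ℝ := fun x u => x / ℓ * max (ℓ - u) 0 - max (x - u) 0 with hg
  have hgc : Continuous fun p : ℝ × ℝ => g p.1 p.2 := by simp only [hg]; fun_prop
  have hgs : ∀ x ∈ Set.Icc 0 ℓ, ∀ u ∈ Set.Icc 0 ℓ, g x u = g u x := by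
    intro x hx u hu
    simp only [hg, max_eq_left (sub_nonneg.2 hx.2), max_eq_left (sub_nonneg.2 hu.2)]
    rcases le_total x u with h | h
    · rw [max_eq_right (sub_nonpos.2 h), max_eq_left (sub_nonneg.2 h)]
      field_simp; ring
    · rw [max_eq_left (sub_nonneg.2 h), max_eq_right (sub_nonpos.2 h)]
      field_simp; ring
  have hae : ∀ᵐ x ∂μ, x ∈ Set.Icc 0 ℓ := hμ
  -- Eliminating the initial slope in favour of the value at `ℓ` turns the Volterra equation into a
  -- Fredholm equation with a symmetric kernel.
  have fredholm : ∀ c : ℂ, ∀ x ∈ Set.Icc 0 ℓ, stringSol μ c x =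
      x / ℓ * stringSol μ c ℓ + c * ∫ u, (g x u : ℂ) * stringSol μ c u ∂μ := by
    intro c x hx
    have hi := fun y => integrable_volterra μ (continuous_stringSol μ c)
      (fun u hu => stringSol_of_nonpos μ c hu) y
    have : ∫ u, (g x u : ℂ) * stringSol μ c u ∂μ =
        x / ℓ * volterra μ (stringSol μ c) ℓ - volterra μ (stringSol μ c) x := by
      unfold volterra
      rw [← integral_const_mul, ← integral_sub ((hi ℓ).const_mul _) (hi x)]
      congr 1; ext u
      simp only [hg, Complex.real_smul]; push_cast; ring
    rw [this, stringSol_eq μ c x, stringSol_eq μ c ℓ, max_eq_left hx.1, max_eq_left hℓ.le]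
    field_simp; ring
  -- The double integral of `g x u * A u * B x` is evaluated in both orders, using the equation of
  -- `B` for one and that of `A` for the other; the comparison is Green's identity.
  set S := ∫ x, (∫ u, (g x u : ℂ) * A u ∂μ) * B x ∂μ with hS
  have hS' : S = ∫ u, A u * ∫ x, (g u x : ℂ) * B x ∂μ ∂μ := by
    rw [hS]
    simp_rw [← integral_mul_const, ← integral_const_mul]
    rw [integral_integral_swap]
    · refine integral_congr_ae (hae.mono fun u hu => integral_congr_ae (hae.mono fun x hx => ?_))
      simp only
      rw [hgs x hx u hu]; ring
    · rw [← Measure.restrict_eq_self_of_ae_mem hae, Measure.prod_restrict]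
      refine ContinuousOn.integrableOn_compact (isCompact_Icc.prod isCompact_Icc) ?_
      refine Continuous.continuousOn ?_
      simp only [Function.uncurry_def]
      fun_prop
  have hbS : b * S = ∫ x, A x * B x ∂μ := by
    rw [hS', ← integral_const_mul]
    refine integral_congr_ae (hae.mono fun x hx => ?_)
    have := fredholm b x hx
    rw [← hB, hb, mul_zero, zero_add] at this
    simp only
    rw [this]; ring
  have haS : a * S = (∫ x, A x * B x ∂μ) - A ℓ / ℓ * ∫ x, x * B x ∂μ := by
    rw [hS, ← integral_const_mul, ← integral_const_mul, ← integral_sub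
      (integrable_of_continuous hμ (by fun_prop)) (integrable_of_continuous hμ (by fun_prop))]
    refine integral_congr_ae (hae.mono fun x hx => ?_)
    simp only
    nth_rewrite 2 [hA]
    rw [fredholm a x hx]; ring
  linear_combination a * (- hbS) + b * haS

lemma integral_normSq_stringSol_pos {μ : Measure ℝ} [IsFiniteMeasure μ] {ℓ : ℝ} (hℓ : 0 < ℓ)
    (hμ : μ (Set.Icc 0 ℓ)ᶜ = 0) {z : ℂ} (hz : stringSol μ z ℓ = 0) :
    0 < ∫ x, Complex.normSq (stringSol μ z x) ∂μ := by
  have hint : Integrable (fun x => Complex.normSq (stringSol μ z x)) μ := by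
    have := (integrable_of_continuous hμ (f := fun x => (Complex.normSq (stringSol μ z x) : ℂ))
      (Complex.continuous_ofReal.comp (Complex.continuous_normSq.comp
        (continuous_stringSol μ z)))).re
    simpa using this
  refine lt_of_le_of_ne (integral_nonneg fun x => Complex.normSq_nonneg _) fun h => ?_
  rw [eq_comm, integral_eq_zero_iff_of_nonneg (fun x => Complex.normSq_nonneg _) hint] at h
  have := stringSol_eq_self_of_eq_zero μ (z := z) hℓ.le (integral_eq_zero_of_ae (h.mono fun x hx => by
    simp only [Pi.zero_apply] at hx ⊢
    rw [Complex.normSq_eq_zero.1 hx, smul_zero]))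
  rw [hz] at this
  exact hℓ.ne' (Complex.ofReal_eq_zero.1 this.symm)

lemma integral_stringSol_mul_conj {μ : Measure ℝ} (z : ℂ) :
    ∫ x, stringSol μ z x * stringSol μ (starRingEnd ℂ z) x ∂μ =
      (∫ x, Complex.normSq (stringSol μ z x) ∂μ : ℝ) := by
  rw [← integral_complex_ofReal]
  congr 1; ext x
  rw [stringSol_conj, Complex.mul_conj]

/-- Dirichlet eigenvalues are positive reals. -/
theorem exists_pos_of_stringSol_eq_zero {μ : Measure ℝ} [IsFiniteMeasure μ] {ℓ : ℝ} (hℓ : 0 < ℓ)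
    (hμ : μ (Set.Icc 0 ℓ)ᶜ = 0) {z : ℂ} (hz : stringSol μ z ℓ = 0) : ∃ t : ℝ, 0 < t ∧ z = t := by
  have hz' : stringSol μ (starRingEnd ℂ z) ℓ = 0 := by rw [stringSol_conj, hz, map_zero]
  -- Taking the conjugate parameter as second solution makes the boundary term vanish and the
  -- integrand `|φ|²`, so `z` equals its conjugate.
  have h := stringSol_green hℓ hμ z hz'
  rw [hz, zero_div, neg_zero, zero_mul, zero_mul, integral_stringSol_mul_conj] at h
  have h1 : z - starRingEnd ℂ z = 0 := (mul_eq_zero.1 h).resolve_right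
    (Complex.ofReal_ne_zero.2 (integral_normSq_stringSol_pos hℓ hμ hz).ne')
  obtain ⟨t, rfl⟩ := Complex.conj_eq_iff_real.1 (sub_eq_zero.1 h1).symm
  refine ⟨t, not_le.1 fun ht => ?_, rfl⟩
  have := le_stringSol_of_nonpos μ ht hℓ.le
  rw [hz, Complex.zero_re] at this
  linarith

end

/-! ### Convergence of solutions under weak convergence of the measures. -/

/-- The elementary half of Arzelà–Ascoli: the pointwise limit inherits the Lipschitz constant, so
closeness at a point spreads to a ball of fixed radius, and compactness finishes. -/
lemma tendstoUniformlyOn_of_lipschitz {ι E : Type*} [NormedAddCommGroup E] {l : Filter ι}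
    {F : ι → ℝ → E} {f : ℝ → E} {S : Set ℝ} (hS : IsCompact S) {C : ℝ}
    (hlip : ∀ᶠ i in l, ∀ x ∈ S, ∀ y ∈ S, ‖F i x - F i y‖ ≤ C * |x - y|)
    (hpt : ∀ x ∈ S, Tendsto (fun i => F i x) l (𝓝 (f x))) : TendstoUniformlyOn F f l S := by
  rcases l.eq_or_neBot with rfl | hl
  · intro u _; simp
  have hf : ∀ x ∈ S, ∀ y ∈ S, ‖f x - f y‖ ≤ C * |x - y| := fun x hx y hy =>
    le_of_tendsto ((hpt x hx).sub (hpt y hy)).norm (hlip.mono fun i hi => hi x hx y hy)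
  rw [← tendstoLocallyUniformlyOn_iff_tendstoUniformlyOn_of_compact hS,
    Metric.tendstoLocallyUniformlyOn_iff]
  intro ε hε x hx
  have hC : 0 < |C| + 1 := by positivity
  refine ⟨S ∩ Metric.ball x (ε / 4 / (|C| + 1)), inter_mem_nhdsWithin _ (Metric.ball_mem_nhds _
    (by positivity)), ?_⟩
  filter_upwards [hlip, (tendsto_iff_norm_sub_tendsto_zero.1 (hpt x hx)).eventually
    (gt_mem_nhds (by positivity : (0 : ℝ) < ε / 4))] with i hi hix y hy
  have h0 : C * |x - y| ≤ ε / 4 := by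
    have h1 : |x - y| < ε / 4 / (|C| + 1) := by
      have := hy.2
      rwa [Metric.mem_ball, dist_comm, Real.dist_eq] at this
    rw [lt_div_iff₀ hC] at h1
    nlinarith [le_abs_self C, abs_nonneg (x - y)]
  have h1 := hf x hx y hy.1
  have h2 := hi x hx y hy.1
  rw [dist_eq_norm]
  calc ‖f y - F i y‖ = ‖(F i x - F i y) - (F i x - f x) - (f x - f y)‖ := by congr 1; abel
    _ ≤ ‖F i x - F i y‖ + ‖F i x - f x‖ + ‖f x - f y‖ :=
      (norm_sub_le _ _).trans (add_le_add_left (norm_sub_le _ _) _)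
    _ < ε := by linarith

/-- Convergence of the integrals of bounded continuous functions. -/
def WeakTendsto (μs : ℕ → Measure ℝ) (μ : Measure ℝ) : Prop :=
  ∀ f : BoundedContinuousFunction ℝ ℝ,
    Tendsto (fun n => ∫ x, f x ∂μs n) atTop (𝓝 (∫ x, f x ∂μ))

namespace WeakTendsto

variable {μs : ℕ → Measure ℝ} {μ : Measure ℝ}

lemma const (μ : Measure ℝ) : WeakTendsto (fun _ => μ) μ := fun _ => tendsto_const_nhds

lemma integral (h : WeakTendsto μs μ) {f : ℝ → ℝ} (hf : Continuous f) {B : ℝ}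
    (hB : ∀ x, ‖f x‖ ≤ B) : Tendsto (fun n => ∫ x, f x ∂μs n) atTop (𝓝 (∫ x, f x ∂μ)) :=
  h (BoundedContinuousFunction.ofNormedAddCommGroup f hf B hB)

lemma mass (h : WeakTendsto μs μ) :
    Tendsto (fun n => (μs n).real Set.univ) atTop (𝓝 (μ.real Set.univ)) := by
  simpa using h.integral (f := fun _ => 1) continuous_const (B := 1) (by simp)

lemma mass_le (h : WeakTendsto μs μ) :
    ∀ᶠ n in atTop, (μs n).real Set.univ ≤ μ.real Set.univ + 1 :=
  h.mass.eventually (ge_mem_nhds (lt_add_one _))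

variable [∀ n, IsFiniteMeasure (μs n)] [IsFiniteMeasure μ]

-- With `f` frozen, kernel times `f` is a bounded continuous test function. Replacing `f` by `F n`
-- costs at most the uniform distance on `[0, R]` times `R` times the mass.
omit [IsFiniteMeasure μ] in
lemma volterra (h : WeakTendsto μs μ) {F : ℕ → ℝ → ℝ} {f : ℝ → ℝ} {R : ℝ}
    (hF : ∀ n, Continuous (F n)) (hF0 : ∀ n, ∀ u ≤ 0, F n u = 0) (hf : Continuous f)
    (hf0 : ∀ u ≤ 0, f u = 0) (hu : TendstoUniformlyOn F f atTop (Set.Icc 0 R)) {x : ℝ}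
    (hx : x ∈ Set.Icc 0 R) :
    Tendsto (fun n => _root_.volterra (μs n) (F n) x) atTop (𝓝 (_root_.volterra μ f x)) := by
  have h1 : Tendsto (fun n => _root_.volterra (μs n) f x) atTop (𝓝 (_root_.volterra μ f x)) := by
    have hc : Continuous fun u => max (x - u) 0 • f u := by fun_prop
    obtain ⟨B, hB⟩ := (HasCompactSupport.intro (f := fun u => max (x - u) 0 • f u)
      (isCompact_Icc (a := 0) (b := x)) fun u hu => by
        rcases le_total u 0 with h | h
        · simp [hf0 u h]
        · have : x < u := not_le.1 fun h' => hu ⟨h, h'⟩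
          simp [max_eq_right (by linarith : x - u ≤ 0)]).exists_bound_of_continuous hc
    exact h.integral hc hB
  refine (tendsto_iff_of_dist ?_).2 h1
  rw [Metric.tendsto_nhds]
  intro ε hε
  have hR := hx.1.trans hx.2
  -- The added 1 keeps the denominator positive when `R = 0` and leaves the slack `η` that makes the
  -- final inequality strict.
  have hM : 0 < R * (μ.real Set.univ + 1) + 1 := by positivity
  filter_upwards [Metric.tendstoUniformlyOn_iff.1 hu _ (div_pos hε hM), h.mass_le] with n hn hm
  rw [Real.dist_0_eq_abs, abs_of_nonneg dist_nonneg, dist_eq_norm, _root_.volterra,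
    _root_.volterra, ← integral_sub (integrable_volterra _ (hF n) (hF0 n) x)
    (integrable_volterra _ hf hf0 x)]
  set η := ε / (R * (μ.real Set.univ + 1) + 1) with hη
  have hη0 : 0 < η := div_pos hε hM
  refine (norm_integral_le_of_norm_le_const (C := R * η) (.of_forall fun u => ?_)).trans_lt ?_
  · rw [← smul_sub, norm_smul, Real.norm_eq_abs, abs_of_nonneg (le_max_right _ _)]
    rcases le_total u 0 with h | h
    · simp only [hf0 u h, hF0 n u h, sub_self, norm_zero, mul_zero]; positivity
    rcases le_total x u with hxu | hxu
    · rw [max_eq_right (sub_nonpos.2 hxu), zero_mul]; positivity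
    · have := hn u ⟨h, hxu.trans hx.2⟩
      rw [dist_comm, dist_eq_norm] at this
      exact mul_le_mul (max_le (by linarith [hx.2]) hR) this.le (norm_nonneg _) hR
  · calc R * η * (μs n).real Set.univ ≤ R * η * (μ.real Set.univ + 1) := by gcongr
      _ = ε - η := by rw [hη]; field_simp; ring
      _ < ε := by linarith

lemma stringCoeff (h : WeakTendsto μs μ) {R : ℝ} (hR : 0 ≤ R) (j : ℕ) :
    TendstoUniformlyOn (fun n => stringCoeff (μs n) j) (stringCoeff μ j) atTop (Set.Icc 0 R) := by
  induction j with
  | zero =>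
    simp only [_root_.stringCoeff]
    rw [Metric.tendstoUniformlyOn_iff]
    intro ε hε
    simp [hε]
  | succ j ih =>
    refine tendstoUniformlyOn_of_lipschitz isCompact_Icc
      (C := R * (((μ.real Set.univ + 1) * R) ^ j / j.factorial) * (μ.real Set.univ + 1)) ?_ ?_
    · filter_upwards [h.mass_le] with n hn x hx y hy
      refine (norm_volterra_sub_le (μs n) (continuous_stringCoeff _ j)
        (fun u hu => stringCoeff_of_nonpos _ j hu)
        (B := R * (((μ.real Set.univ + 1) * R) ^ j / j.factorial)) (R := R) (by positivity)
        (fun u hu => ?_) hx.2 hy.2).trans (by gcongr)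
      rw [Real.norm_eq_abs, abs_of_nonneg (stringCoeff_nonneg _ j u)]
      exact stringCoeff_le _ j hR hu hn
    · intro x hx
      exact h.volterra (fun n => continuous_stringCoeff _ j)
        (fun n u hu => stringCoeff_of_nonpos _ j hu) (continuous_stringCoeff _ j)
        (fun u hu => stringCoeff_of_nonpos _ j hu) ih hx

/-- Pointwise convergence is dominated convergence of the series; the uniform Lipschitz bound
upgrades it. A general filter with index map `N` covers subsequences as well as parameters varying
with a fixed measure. -/
lemma stringSol (h : WeakTendsto μs μ) {R : ℝ} (hR : 0 ≤ R) {ι : Type*} {l : Filter ι}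
    {N : ι → ℕ} (hN : Tendsto N l atTop) {w : ι → ℂ} {z : ℂ} (hw : Tendsto w l (𝓝 z)) :
    TendstoUniformlyOn (fun i => stringSol (μs (N i)) (w i)) (stringSol μ z) l (Set.Icc 0 R) := by
  have hm := hN.eventually h.mass_le
  have hz : ∀ᶠ i in l, ‖w i‖ ≤ ‖z‖ + 1 := hw.norm.eventually (ge_mem_nhds (lt_add_one _))
  refine tendstoUniformlyOn_of_lipschitz (C := 1 + (‖z‖ + 1) * (R * Real.exp ((‖z‖ + 1) *
    (μ.real Set.univ + 1) * R) * (μ.real Set.univ + 1))) isCompact_Icc ?_ fun x hx => ?_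
  · filter_upwards [hm, hz] with i h1 h2 x hx y hy
    exact norm_stringSol_sub_le _ _ hR hx.2 hy.2 h1 h2
  · unfold _root_.stringSol
    refine tendsto_tsum_of_dominated_convergence
      (summable_expBound R ((‖z‖ + 1) * (μ.real Set.univ + 1) * R)) (fun j => ?_) ?_
    · exact (hw.neg.pow j).mul ((Complex.continuous_ofReal.tendsto _).comp
        (((h.stringCoeff hR j).tendsto_at hx).comp hN))
    · filter_upwards [hm, hz] with i h1 h2 j
      exact norm_stringSol_term_le _ _ j hR hx.2 h1 h2

lemma stringSol_at (h : WeakTendsto μs μ) {ι : Type*} {l : Filter ι}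
    {N : ι → ℕ} (hN : Tendsto N l atTop) {w : ι → ℂ} {z : ℂ} (hw : Tendsto w l (𝓝 z))
    {y : ι → ℝ} {x : ℝ} (hx : 0 < x) (hy : Tendsto y l (𝓝 x)) :
    Tendsto (fun i => _root_.stringSol (μs (N i)) (w i) (y i)) l (𝓝 (_root_.stringSol μ z x)) :=
  (h.stringSol (R := x + 1) (by positivity) hN hw).tendstoLocallyUniformlyOn.tendsto_comp
    (continuous_stringSol μ z).continuousWithinAt ⟨hx.le, by linarith⟩
    (tendsto_nhdsWithin_iff.2 ⟨hy, hy.eventually (Icc_mem_nhds hx (lt_add_one x))⟩)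

-- The integrands may be unbounded on the line, but the measures live on `[0, R]`, so composing with
-- the projection onto that interval changes no integral and yields bounded test functions.
omit [IsFiniteMeasure μ] in
lemma integral_uniform (h : WeakTendsto μs μ) {R : ℝ} (hR : 0 ≤ R)
    (hs : ∀ᶠ n in atTop, (μs n) (Set.Icc 0 R)ᶜ = 0) (hμ : μ (Set.Icc 0 R)ᶜ = 0)
    {ι : Type*} {l : Filter ι} {N : ι → ℕ} (hN : Tendsto N l atTop) {F : ι → ℝ → ℝ} {f : ℝ → ℝ}
    (hF : ∀ i, Continuous (F i)) (hf : Continuous f)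
    (hu : TendstoUniformlyOn F f l (Set.Icc 0 R)) :
    Tendsto (fun i => ∫ x, F i x ∂μs (N i)) l (𝓝 (∫ x, f x ∂μ)) := by
  set c : ℝ → ℝ := fun u => max 0 (min R u) with hc
  have hcm : ∀ u, c u ∈ Set.Icc 0 R := fun u => ⟨le_max_left _ _, max_le hR (min_le_left _ _)⟩
  have hcc : Continuous c := by fun_prop
  have hce : ∀ u ∈ Set.Icc 0 R, c u = u := fun u hu => by
    simp only [hc, min_eq_right hu.2, max_eq_right hu.1]
  have hclamp : ∀ {ν : Measure ℝ} (g : ℝ → ℝ), ν (Set.Icc 0 R)ᶜ = 0 →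
      ∫ x, g x ∂ν = ∫ x, g (c x) ∂ν := fun {ν} g hν => by
    have hae : ∀ᵐ x ∂ν, x ∈ Set.Icc 0 R := hν
    exact integral_congr_ae (hae.mono fun x hx => by simp only [hce x hx])
  obtain ⟨B, hB⟩ := (isCompact_Icc (a := 0) (b := R)).exists_bound_of_continuousOn hf.continuousOn
  have h1 := (h.integral (hf.comp hcc) (fun x => hB _ (hcm x))).comp hN
  simp only [Function.comp_def] at h1
  rw [hclamp f hμ]
  refine (tendsto_iff_of_dist ?_).2 h1
  rw [Metric.tendsto_nhds]
  intro ε hε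
  have hM : 0 < μ.real Set.univ + 1 + 1 := by positivity
  filter_upwards [Metric.tendstoUniformlyOn_iff.1 hu _ (div_pos hε hM), hN.eventually h.mass_le,
    hN.eventually hs] with i hi hm hsi
  have hint : ∀ {g : ℝ → ℝ}, Continuous g → Integrable (fun x => g (c x)) (μs (N i)) := by
    intro g hg
    obtain ⟨B, hB⟩ := (isCompact_Icc (a := 0) (b := R)).exists_bound_of_continuousOn
      hg.continuousOn
    exact Integrable.of_bound (hg.comp hcc).aestronglyMeasurable B (.of_forall fun x => hB _ (hcm x))
  rw [Real.dist_0_eq_abs, abs_of_nonneg dist_nonneg, dist_eq_norm, hclamp (F i) hsi,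
    ← integral_sub (hint (hF i)) (hint hf)]
  set η := ε / (μ.real Set.univ + 1 + 1) with hη
  have hη0 : 0 < η := div_pos hε hM
  refine (norm_integral_le_of_norm_le_const (C := η) (.of_forall fun u => ?_)).trans_lt ?_
  · rw [← dist_eq_norm, dist_comm]
    exact (hi _ (hcm u)).le
  · calc η * (μs (N i)).real Set.univ ≤ η * (μ.real Set.univ + 1) := by gcongr
      _ = ε - η := by rw [hη]; field_simp; ring
      _ < ε := by linarith

end WeakTendsto

/-! ### The characteristic function at real parameters: isolated zeros and sign changes. -/

/-- `stringSol` at real parameters. -/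
noncomputable def realSol (μ : Measure ℝ) (t x : ℝ) : ℝ := (stringSol μ t x).re

lemma ofReal_realSol (μ : Measure ℝ) (t x : ℝ) : (realSol μ t x : ℂ) = stringSol μ t x :=
  stringSol_ofReal_re μ t x

lemma realSol_eq_zero_iff (μ : Measure ℝ) (t x : ℝ) :
    realSol μ t x = 0 ↔ stringSol μ t x = 0 := by
  rw [← ofReal_realSol, Complex.ofReal_eq_zero]

section

variable {μ : Measure ℝ} [IsFiniteMeasure μ] {ℓ : ℝ}

lemma continuous_realSol (μ : Measure ℝ) [IsFiniteMeasure μ] (t : ℝ) : Continuous (realSol μ t) :=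
  Complex.continuous_re.comp (continuous_stringSol μ t)

lemma realSol_green (hℓ : 0 < ℓ) (hμ : μ (Set.Icc 0 ℓ)ᶜ = 0) (a : ℝ) {b : ℝ}
    (hb : realSol μ b ℓ = 0) :
    (a - b) * ∫ x, realSol μ a x * realSol μ b x ∂μ =
      -(realSol μ a ℓ / ℓ) * b * ∫ x, x * realSol μ b x ∂μ := by
  have h := stringSol_green hℓ hμ a ((realSol_eq_zero_iff μ b ℓ).1 hb)
  simp only [← ofReal_realSol, ← Complex.ofReal_mul] at h
  rw [integral_complex_ofReal, integral_complex_ofReal] at h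
  exact_mod_cast h

lemma integral_realSol_mul_eq_zero (hℓ : 0 < ℓ) (hμ : μ (Set.Icc 0 ℓ)ᶜ = 0) {a b : ℝ}
    (hab : a ≠ b) (ha : realSol μ a ℓ = 0) (hb : realSol μ b ℓ = 0) :
    ∫ x, realSol μ a x * realSol μ b x ∂μ = 0 := by
  have h := realSol_green hℓ hμ a hb
  rw [ha, zero_div, neg_zero, zero_mul, zero_mul] at h
  exact (mul_eq_zero.1 h).resolve_left (sub_ne_zero.2 hab)

lemma integral_realSol_mul_self_pos (hℓ : 0 < ℓ) (hμ : μ (Set.Icc 0 ℓ)ᶜ = 0) {t : ℝ}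
    (ht : realSol μ t ℓ = 0) : 0 < ∫ x, realSol μ t x * realSol μ t x ∂μ := by
  have := integral_normSq_stringSol_pos hℓ hμ ((realSol_eq_zero_iff μ t ℓ).1 ht)
  simpa only [← ofReal_realSol, Complex.normSq_ofReal] using this

lemma tendsto_realSol {μs : ℕ → Measure ℝ} [∀ n, IsFiniteMeasure (μs n)] (h : WeakTendsto μs μ)
    {ι : Type*} {l : Filter ι} {N : ι → ℕ} (hN : Tendsto N l atTop) {w : ι → ℝ} {z : ℝ}
    (hw : Tendsto w l (𝓝 z)) {y : ι → ℝ} {x : ℝ} (hx : 0 < x) (hy : Tendsto y l (𝓝 x)) :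
    Tendsto (fun i => realSol (μs (N i)) (w i) (y i)) l (𝓝 (realSol μ z x)) :=
  (Complex.continuous_re.tendsto _).comp
    (h.stringSol_at hN ((Complex.continuous_ofReal.tendsto _).comp hw) hx hy)

lemma tendsto_integral_realSol_mul {μs : ℕ → Measure ℝ} [∀ n, IsFiniteMeasure (μs n)]
    (h : WeakTendsto μs μ) {R : ℝ} (hR : 0 ≤ R)
    (hs : ∀ᶠ n in atTop, (μs n) (Set.Icc 0 R)ᶜ = 0) (hμ : μ (Set.Icc 0 R)ᶜ = 0)
    {ι : Type*} {l : Filter ι} {N : ι → ℕ} (hN : Tendsto N l atTop) {v w : ι → ℝ} {a b : ℝ}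
    (hv : Tendsto v l (𝓝 a)) (hw : Tendsto w l (𝓝 b)) :
    Tendsto (fun i => ∫ x, realSol (μs (N i)) (v i) x * realSol (μs (N i)) (w i) x ∂μs (N i)) l
      (𝓝 (∫ x, realSol μ a x * realSol μ b x ∂μ)) := by
  refine h.integral_uniform hR hs hμ hN
    (fun i => (continuous_realSol _ _).mul (continuous_realSol _ _))
    ((continuous_realSol _ _).mul (continuous_realSol _ _)) ?_
  have key : ∀ {v : ι → ℝ} {a : ℝ}, Tendsto v l (𝓝 a) →
      TendstoUniformlyOn (fun i => realSol (μs (N i)) (v i)) (realSol μ a) l (Set.Icc 0 R) := by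
    intro v a hv
    exact Complex.reCLM.uniformContinuous.comp_tendstoUniformlyOn
      (h.stringSol hR hN ((Complex.continuous_ofReal.tendsto _).comp hv))
  exact ((key hv).tendstoLocallyUniformlyOn.mul₀ (key hw).tendstoLocallyUniformlyOn
    (continuous_realSol _ _).continuousOn (continuous_realSol _ _).continuousOn)
    |> (tendstoLocallyUniformlyOn_iff_tendstoUniformlyOn_of_compact isCompact_Icc).1

-- Lets continuity in the parameter be read off from the convergence lemmas: the sequence of
-- measures is taken constant and its index is a dummy variable.
omit [IsFiniteMeasure μ] in
lemma tendsto_of_tendsto_snd {α β : Type*} {f : α → β} {l : Filter α} {l' : Filter β}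
    (h : Tendsto (fun p : ℕ × α => f p.2) (atTop ×ˢ l) l') : Tendsto f l l' := by
  rw [← map_snd_prod (f := (atTop : Filter ℕ)) (g := l)]
  exact tendsto_map'_iff.2 h

lemma continuous_realSol_param (μ : Measure ℝ) [IsFiniteMeasure μ] {x : ℝ} (hx : 0 < x) :
    Continuous fun t => realSol μ t x :=
  continuous_iff_continuousAt.2 fun _ => tendsto_of_tendsto_snd
    (tendsto_realSol (μ := μ) (WeakTendsto.const μ) tendsto_fst tendsto_snd hx tendsto_const_nhds)

lemma eventually_integral_realSol_mul_pos (hℓ : 0 < ℓ) (hμ : μ (Set.Icc 0 ℓ)ᶜ = 0) {w : ℝ}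
    (hw : realSol μ w ℓ = 0) : ∀ᶠ t in 𝓝 w, 0 < ∫ x, realSol μ t x * realSol μ w x ∂μ :=
  (tendsto_of_tendsto_snd (tendsto_integral_realSol_mul (WeakTendsto.const μ) hℓ.le
    (.of_forall fun _ => hμ) hμ tendsto_fst tendsto_snd tendsto_const_nhds)).eventually
      (lt_mem_nhds (integral_realSol_mul_self_pos hℓ hμ hw))

/-- The Dirichlet eigenvalues do not accumulate. -/
lemma eventually_realSol_ne_zero (hℓ : 0 < ℓ) (hμ : μ (Set.Icc 0 ℓ)ᶜ = 0) (w : ℝ) :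
    ∀ᶠ z in 𝓝[≠] w, realSol μ z ℓ ≠ 0 := by
  by_cases hw : realSol μ w ℓ = 0
  -- A second zero `t` would make the two solutions orthogonal, while their inner product is
  -- positive for `t` near `w`.
  · filter_upwards [(eventually_integral_realSol_mul_pos hℓ hμ hw).filter_mono nhdsWithin_le_nhds,
      self_mem_nhdsWithin] with t ht htw h0
    exact ht.ne' (integral_realSol_mul_eq_zero hℓ hμ htw h0 hw)
  · exact ((continuous_realSol_param μ hℓ).continuousAt.eventually_ne hw).filter_mono
      nhdsWithin_le_nhds

/-- The characteristic function `t ↦ realSol μ t ℓ` changes sign at each of its zeros. -/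
lemma exists_realSol_mul_neg (hℓ : 0 < ℓ) (hμ : μ (Set.Icc 0 ℓ)ᶜ = 0) {w : ℝ}
    (hw : realSol μ w ℓ = 0) {ε : ℝ} (hε : 0 < ε) :
    ∃ s t, w - ε < s ∧ s < t ∧ t < w + ε ∧ realSol μ s ℓ * realSol μ t ℓ < 0 := by
  obtain ⟨δ, hδ, h⟩ := Metric.eventually_nhds_iff.1 (eventually_integral_realSol_mul_pos hℓ hμ hw)
  set r := min ε δ / 2 with hr
  have hr0 : 0 < r := by positivity
  have hrε : r < ε := by have := min_le_left ε δ; have := lt_min hε hδ; linarith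
  have hrδ : r < δ := by have := min_le_right ε δ; have := lt_min hε hδ; linarith
  refine ⟨w - r, w + r, by linarith, by linarith, by linarith, ?_⟩
  have h1 := realSol_green hℓ hμ (w - r) hw
  have h2 := realSol_green hℓ hμ (w + r) hw
  have p1 := h (y := w - r) (by simpa [Real.dist_eq, abs_of_pos hr0] using hrδ)
  have p2 := h (y := w + r) (by simpa [Real.dist_eq, abs_of_pos hr0] using hrδ)
  -- Green's identity reads `realSol μ t ℓ * κ = -(t - w) * ∫ φ_t φ_w`, and the integral is positive
  -- near `w`. The sign on the two sides of `w` is thus opposite, without differentiating in `t`.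
  set κ := w / ℓ * ∫ x, x * realSol μ w x ∂μ with hκ
  have e1 : realSol μ (w - r) ℓ * κ = r * ∫ x, realSol μ (w - r) x * realSol μ w x ∂μ := by
    rw [hκ]; linear_combination h1
  have e2 : realSol μ (w + r) ℓ * κ = -(r * ∫ x, realSol μ (w + r) x * realSol μ w x ∂μ) := by
    rw [hκ]; linear_combination h2
  have h3 : (realSol μ (w - r) ℓ * realSol μ (w + r) ℓ) * κ ^ 2 < 0 := by
    have : (realSol μ (w - r) ℓ * realSol μ (w + r) ℓ) * κ ^ 2 =
        (realSol μ (w - r) ℓ * κ) * (realSol μ (w + r) ℓ * κ) := by ring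
    rw [this, e1, e2, mul_neg, neg_lt_zero]
    positivity
  exact neg_of_mul_neg_left h3 (sq_nonneg _)

/-- Near each Dirichlet eigenvalue of the limit there are eventually Dirichlet eigenvalues. -/
lemma eventually_exists_realSol_eq_zero {μs : ℕ → Measure ℝ} [∀ n, IsFiniteMeasure (μs n)]
    (h : WeakTendsto μs μ) (hℓ : 0 < ℓ) (hμ : μ (Set.Icc 0 ℓ)ᶜ = 0) {L : ℕ → ℝ}
    (hL : Tendsto L atTop (𝓝 ℓ)) {w : ℝ} (hw : realSol μ w ℓ = 0) {ε : ℝ} (hε : 0 < ε) :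
    ∀ᶠ n in atTop, ∃ t, |t - w| < ε ∧ realSol (μs n) t (L n) = 0 := by
  obtain ⟨s, t, hs, hst, ht, hneg⟩ := exists_realSol_mul_neg hℓ hμ hw hε
  have hlim : ∀ r : ℝ, Tendsto (fun n => realSol (μs n) r (L n)) atTop (𝓝 (realSol μ r ℓ)) :=
    fun r => tendsto_realSol h tendsto_id tendsto_const_nhds hℓ hL
  filter_upwards [((hlim s).mul (hlim t)).eventually (gt_mem_nhds hneg),
    hL.eventually (lt_mem_nhds hℓ)] with n hn hLn
  have hc := (continuous_realSol_param (μs n) hLn).continuousOn (s := Set.Icc s t)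
  have : ∃ r ∈ Set.Icc s t, realSol (μs n) r (L n) = 0 := by
    rcases mul_neg_iff.1 hn with ⟨h1, h2⟩ | ⟨h1, h2⟩
    · exact intermediate_value_Icc' hst.le hc ⟨h2.le, h1.le⟩
    · exact intermediate_value_Icc hst.le hc ⟨h1.le, h2.le⟩
  obtain ⟨r, hr, h0⟩ := this
  exact ⟨r, abs_lt.2 ⟨by linarith [hr.1], by linarith [hr.2]⟩, h0⟩

end

/-! ### Convergence of ordered lists to a locally finite set. -/

section Ordered

variable {Z : Set ℝ} {a : ℕ → ℕ → ℝ}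

/-- The infimum lies in the closure; were it outside the set, it would be an accumulation point of
`Z`. -/
lemma csInf_mem_of_discrete (hdisc : ∀ w : ℝ, ∀ᶠ z in 𝓝[≠] w, z ∉ Z) {v : ℝ}
    (hne : (Z ∩ Set.Ioi v).Nonempty) : sInf (Z ∩ Set.Ioi v) ∈ Z ∩ Set.Ioi v := by
  set S := Z ∩ Set.Ioi v
  have hbdd : BddBelow S := ⟨v, fun x hx => hx.2.le⟩
  by_contra hcon
  have h1 := csInf_mem_closure hne hbdd
  rw [mem_closure_iff_frequently] at h1
  refine h1 ?_
  have h2 := hdisc (sInf S)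
  rw [eventually_nhdsWithin_iff] at h2
  filter_upwards [h2] with z hz hzS
  exact hz (by rintro rfl; exact hcon hzS) hzS.1

/-- If `v` is the limit of the `k`-th points, the `k+1`-st points converge to the least element
of `Z` above `v`. -/
lemma tendsto_next
    (hmono : ∀ n, 1 ≤ n → StrictMonoOn (a n) (Set.Ico 1 n))
    (hpos : ∀ n, 1 ≤ n → ∀ k ∈ Set.Ico 1 n, 0 < a n k)
    (hbdd : ∀ k, 1 ≤ k → ∃ C, ∀ᶠ n in atTop, a n k ≤ C)
    (hcluster : ∀ k, 1 ≤ k → ∀ φ : ℕ → ℕ, StrictMono φ → ∀ w,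
      Tendsto (fun i => a (φ i) k) atTop (𝓝 w) → w ∈ Z)
    (hnear : ∀ z ∈ Z, ∀ ε, 0 < ε → ∀ᶠ n in atTop, ∃ k ∈ Set.Ico 1 n, |a n k - z| < ε)
    (hsep : ∀ k, 1 ≤ k → ∀ φ : ℕ → ℕ, StrictMono φ → ∀ w,
      Tendsto (fun i => a (φ i) k) atTop (𝓝 w) → Tendsto (fun i => a (φ i) (k + 1)) atTop (𝓝 w) →
        False)
    (hZ : ∀ z ∈ Z, 0 < z) (hdisc : ∀ w : ℝ, ∀ᶠ z in 𝓝[≠] w, z ∉ Z)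
    (k : ℕ) {v : ℝ} (hv : (k = 0 ∧ v = 0) ∨ (1 ≤ k ∧ Tendsto (fun n => a n k) atTop (𝓝 v))) :
    sInf (Z ∩ Set.Ioi v) ∈ Z ∩ Set.Ioi v ∧
      Tendsto (fun n => a n (k + 1)) atTop (𝓝 (sInf (Z ∩ Set.Ioi v))) := by
  -- Subsequential limits lie in `Z` by `hcluster`; they are at least `v` by monotonicity and differ
  -- from `v` by `hsep`.
  have hsub : ∀ φ : ℕ → ℕ, StrictMono φ → ∀ u, Tendsto (fun i => a (φ i) (k + 1)) atTop (𝓝 u) →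
      u ∈ Z ∩ Set.Ioi v := by
    intro φ hφ u hu
    have huZ := hcluster (k + 1) (by omega) φ hφ u hu
    refine ⟨huZ, ?_⟩
    rcases hv with ⟨-, rfl⟩ | ⟨hk, hv⟩
    · exact hZ u huZ
    · have hvφ := hv.comp hφ.tendsto_atTop
      refine lt_of_le_of_ne (le_of_tendsto_of_tendsto hvφ hu ?_) ?_
      · filter_upwards [hφ.tendsto_atTop.eventually_gt_atTop (k + 1)] with i hi
        exact (hmono (φ i) (by omega) ⟨hk, by omega⟩ ⟨by omega, hi⟩ (Nat.lt_succ_self k)).le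
      · rintro rfl
        exact hsep k hk φ hφ _ hvφ hu
  obtain ⟨C, hC⟩ := hbdd (k + 1) (by omega)
  have hmem : ∀ᶠ n in atTop, a n (k + 1) ∈ Set.Icc 0 C := by
    filter_upwards [hC, eventually_gt_atTop (k + 1)] with n h1 h2
    exact ⟨(hpos n (by omega) (k + 1) ⟨by omega, h2⟩).le, h1⟩
  -- every infinite set of indices contains a convergent subsequence
  have hext : ∀ {p : ℕ → Prop}, (∃ᶠ n in atTop, p n) → ∃ (φ : ℕ → ℕ) (u : ℝ), StrictMono φ ∧
      (∀ i, p (φ i)) ∧ Tendsto (fun i => a (φ i) (k + 1)) atTop (𝓝 u) := by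
    intro p hp
    obtain ⟨φ, hφ, hpφ⟩ := extraction_of_frequently_atTop (hp.and_eventually hmem)
    obtain ⟨u, -, ψ, hψ, hu⟩ := (isCompact_Icc (a := (0 : ℝ)) (b := C)).tendsto_subseq
      (x := fun i => a (φ i) (k + 1)) fun i => (hpφ i).2
    exact ⟨φ ∘ ψ, u, hφ.comp hψ, fun i => (hpφ _).1, hu⟩
  have hne : (Z ∩ Set.Ioi v).Nonempty := by
    obtain ⟨φ, u, hφ, -, hu⟩ := hext (p := fun _ => True) (Frequently.of_forall fun _ => trivial)
    exact ⟨u, hsub φ hφ u hu⟩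
  have hw := csInf_mem_of_discrete hdisc hne
  refine ⟨hw, ?_⟩
  set w := sInf (Z ∩ Set.Ioi v)
  have hvw : v < w := hw.2
  -- Otherwise a subsequence would converge to a point of `Z` above `v` but below the least such
  -- point.
  have hlower : ∀ ε, 0 < ε → ∀ᶠ n in atTop, w - ε < a n (k + 1) := by
    intro ε hε
    by_contra hcon
    obtain ⟨φ, u, hφ, hp, hu⟩ := hext (not_eventually.1 hcon)
    have h1 : w ≤ u := csInf_le ⟨v, fun x hx => hx.2.le⟩ (hsub φ hφ u hu)
    have h2 : u ≤ w - ε := le_of_tendsto' hu fun i => not_lt.1 (hp i)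
    linarith
  -- Row `n` has a point near `w`. Being within `(w - v) / 2` of `w`, it lies above the midpoint of
  -- `v` and `w`, hence above the `k`-th point, so its index is at least `k + 1`.
  have hupper : ∀ ε, 0 < ε → ∀ᶠ n in atTop, a n (k + 1) < w + ε := by
    intro ε hε
    have hk : ∀ᶠ n in atTop, 1 ≤ k → a n k < (v + w) / 2 := by
      rcases hv with ⟨rfl, -⟩ | ⟨-, hv⟩
      · simp
      · exact (hv.eventually (gt_mem_nhds (by linarith))).mono fun n hn _ => hn
    filter_upwards [hk, hnear w hw.1 (min ε ((w - v) / 2)) (lt_min hε (by linarith)),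
      eventually_gt_atTop (k + 1)] with n h1 ⟨j, hj, hjw⟩ hn
    have hjε := (abs_lt.1 (hjw.trans_le (min_le_left _ _))).2
    have hjv := (abs_lt.1 (hjw.trans_le (min_le_right _ _))).1
    have hkj : k + 1 ≤ j := by
      by_contra hcon
      have hj1 := hj.1
      have := (hmono n (by omega)).monotoneOn hj ⟨by omega, by omega⟩ (by omega : j ≤ k)
      have := h1 (by omega)
      linarith
    have := (hmono n (by omega)).monotoneOn ⟨by omega, hn⟩ hj hkj
    linarith
  rw [Metric.tendsto_nhds]
  intro ε hε
  filter_upwards [hlower ε hε, hupper ε hε] with n h1 h2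
  rw [Real.dist_eq, abs_lt]
  constructor <;> linarith

/-- Convergence of ordered point configurations to a locally finite set. -/
theorem exists_limit_enumeration
    (hmono : ∀ n, 1 ≤ n → StrictMonoOn (a n) (Set.Ico 1 n))
    (hpos : ∀ n, 1 ≤ n → ∀ k ∈ Set.Ico 1 n, 0 < a n k)
    (hbdd : ∀ k, 1 ≤ k → ∃ C, ∀ᶠ n in atTop, a n k ≤ C)
    (hcluster : ∀ k, 1 ≤ k → ∀ φ : ℕ → ℕ, StrictMono φ → ∀ w,
      Tendsto (fun i => a (φ i) k) atTop (𝓝 w) → w ∈ Z)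
    (hnear : ∀ z ∈ Z, ∀ ε, 0 < ε → ∀ᶠ n in atTop, ∃ k ∈ Set.Ico 1 n, |a n k - z| < ε)
    (hsep : ∀ k, 1 ≤ k → ∀ φ : ℕ → ℕ, StrictMono φ → ∀ w,
      Tendsto (fun i => a (φ i) k) atTop (𝓝 w) → Tendsto (fun i => a (φ i) (k + 1)) atTop (𝓝 w) →
        False)
    (hZ : ∀ z ∈ Z, 0 < z) (hdisc : ∀ w : ℝ, ∀ᶠ z in 𝓝[≠] w, z ∉ Z) :
    ∃ lam : ℕ → ℝ, StrictMonoOn lam (Set.Ici 1) ∧ Z = lam '' Set.Ici 1 ∧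
      ∀ k, 1 ≤ k → Tendsto (fun n => a n k) atTop (𝓝 (lam k)) := by
  have step := fun k v => tendsto_next hmono hpos hbdd hcluster hnear hsep hZ hdisc k (v := v)
  -- The value `0` at index `0` is a start below all of `Z`; the list proper begins at index `1`.
  let lam : ℕ → ℝ := fun k => Nat.rec 0 (fun _ v => sInf (Z ∩ Set.Ioi v)) k
  have hP : ∀ k, (k = 0 ∧ lam k = 0) ∨ (1 ≤ k ∧ Tendsto (fun n => a n k) atTop (𝓝 (lam k))) := by
    intro k
    induction k with
    | zero => exact .inl ⟨rfl, rfl⟩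
    | succ k ih => exact .inr ⟨by omega, (step k (lam k) ih).2⟩
  have hmem : ∀ k, lam (k + 1) ∈ Z ∩ Set.Ioi (lam k) := fun k => (step k (lam k) (hP k)).1
  have hlt : StrictMono lam := strictMono_nat_of_lt_succ fun k => (hmem k).2
  refine ⟨lam, hlt.strictMonoOn _, ?_, fun k hk => ((hP k).resolve_left (by omega)).2⟩
  refine Set.Subset.antisymm (fun z hz => ?_) ?_
  -- An unlisted point would bound the whole list, whose limit would then be an accumulation point
  -- of `Z`.
  · by_contra hcon
    have hgt : ∀ k, lam k < z := by
      intro k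
      induction k with
      | zero => exact hZ z hz
      | succ k ih =>
        refine lt_of_le_of_ne (csInf_le ⟨lam k, fun x hx => hx.2.le⟩ ⟨hz, ih⟩) fun h => ?_
        exact hcon ⟨k + 1, by simp, h⟩
    have hlim := tendsto_atTop_ciSup hlt.monotone ⟨z, by rintro _ ⟨k, rfl⟩; exact (hgt k).le⟩
    set u := ⨆ k, lam k
    have hne : ∀ k, lam k < u := fun k => lt_of_lt_of_le (hlt (Nat.lt_succ_self k))
      (hlt.monotone.ge_of_tendsto hlim (k + 1))
    have h2 : Tendsto lam atTop (𝓝[≠] u) :=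
      tendsto_nhdsWithin_iff.2 ⟨hlim, .of_forall fun k => (hne k).ne⟩
    obtain ⟨k, hk, hk1⟩ := ((h2.eventually (hdisc u)).and (eventually_ge_atTop 1)).exists
    obtain ⟨j, rfl⟩ := Nat.exists_eq_add_of_le' hk1
    exact hk (hmem j).1
  · rintro _ ⟨k, hk, rfl⟩
    obtain ⟨j, rfl⟩ := Nat.exists_eq_add_of_le' hk
    exact (hmem j).1

end Ordered

/-! ### Atomic strings and the random walk. -/

section Discrete

variable {U H : ℤ → ℝ}

lemma scalePoint_zero (U : ℤ → ℝ) : scalePoint U 0 = 0 := by simp [scalePoint]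

lemma scalePoint_succ (U : ℤ → ℝ) (k : ℕ) :
    scalePoint U (k + 1) = scalePoint U k + U (k + 1) := by
  rw [scalePoint, Finset.sum_Icc_succ_top (by omega), scalePoint]
  push_cast; rfl

lemma strictMono_scalePoint (hU : ∀ x, 0 < U x) : StrictMono (scalePoint U) :=
  strictMono_nat_of_lt_succ fun k => by rw [scalePoint_succ]; linarith [hU (k + 1)]

lemma scalePoint_nonneg (hU : ∀ x, 0 < U x) (k : ℕ) : 0 ≤ scalePoint U k := by
  have := (strictMono_scalePoint hU).monotone (Nat.zero_le k)
  rwa [scalePoint_zero] at this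

lemma scalePoint_pos (hU : ∀ x, 0 < U x) {k : ℕ} (hk : 1 ≤ k) : 0 < scalePoint U k := by
  have := strictMono_scalePoint hU (show 0 < k by omega)
  rwa [scalePoint_zero] at this

instance isFiniteMeasure_speedMeasure (U H : ℤ → ℝ) (n : ℕ) :
    IsFiniteMeasure (speedMeasure U H n) :=
  ⟨by
    rw [speedMeasure, Measure.coe_finsetSum, Finset.sum_apply]
    refine ENNReal.sum_lt_top.2 fun k _ => ?_
    simp⟩

lemma integral_speedMeasure {E : Type*} [NormedAddCommGroup E] [NormedSpace ℝ E]
    [CompleteSpace E] (hH : ∀ x, 0 < H x) (n : ℕ) (f : ℝ → E) :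
    ∫ x, f x ∂speedMeasure U H n =
      ∑ k ∈ Finset.range (n + 1), H (k : ℤ) • f (scalePoint U k) := by
  rw [speedMeasure, integral_finsetSum_measure]
  · refine Finset.sum_congr rfl fun k _ => ?_
    rw [integral_smul_measure, integral_dirac, ENNReal.toReal_ofReal (hH _).le]
  · exact fun k _ => (integrable_dirac (by simp)).smul_measure (by simp)

lemma speedMeasure_compl (hU : ∀ x, 0 < U x) (H : ℤ → ℝ) (n : ℕ) {R : ℝ}
    (hR : scalePoint U n ≤ R) : speedMeasure U H n (Set.Icc 0 R)ᶜ = 0 := by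
  rw [speedMeasure, Measure.coe_finsetSum, Finset.sum_apply]
  refine Finset.sum_eq_zero fun k hk => ?_
  have : scalePoint U k ∈ Set.Icc 0 R := ⟨scalePoint_nonneg hU k,
    ((strictMono_scalePoint hU).monotone (by simpa [Nat.lt_succ_iff] using hk)).trans hR⟩
  simp [Measure.dirac_apply' _ measurableSet_Icc.compl, this]

/-- The difference equation `-D_m D_x f = z f` at the interior points. -/
def IsStringSeq (U H : ℤ → ℝ) (n : ℕ) (z : ℂ) (f : ℕ → ℂ) : Prop :=
  ∀ k : ℕ, k + 1 < n → (f (k + 2) - f (k + 1)) / U (k + 2) - (f (k + 1) - f k) / U (k + 1) =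
    -z * H (k + 1) * f (k + 1)

/-- The kernel increment between consecutive atoms is `U (k + 1)` for the atoms with `j ≤ k` and
zero for the later ones, so the slope there is `1` minus `z` times a partial sum. -/
lemma stringSol_scalePoint_succ_sub (hU : ∀ x, 0 < U x) (hH : ∀ x, 0 < H x) {n k : ℕ}
    (hk : k < n) (z : ℂ) :
    stringSol (speedMeasure U H n) z (scalePoint U (k + 1)) -
        stringSol (speedMeasure U H n) z (scalePoint U k) =
      U (k + 1) * (1 - z * ∑ j ∈ Finset.range (k + 1),
        H (j : ℤ) * stringSol (speedMeasure U H n) z (scalePoint U j)) := by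
  set φ := stringSol (speedMeasure U H n) z with hφ
  have hmono := (strictMono_scalePoint hU).monotone
  have key : volterra (speedMeasure U H n) φ (scalePoint U (k + 1)) -
      volterra (speedMeasure U H n) φ (scalePoint U k) =
      U (k + 1) * ∑ j ∈ Finset.range (k + 1), H (j : ℤ) * φ (scalePoint U j) := by
    unfold volterra
    rw [integral_speedMeasure hH, integral_speedMeasure hH, ← Finset.sum_sub_distrib,
      Finset.mul_sum]
    rw [← Finset.sum_subset (Finset.range_mono (by omega : k + 1 ≤ n + 1))]
    · refine Finset.sum_congr rfl fun j hj => ?_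
      have hj' : j ≤ k := by simpa [Nat.lt_succ_iff] using hj
      rw [max_eq_left (sub_nonneg.2 (hmono hj')),
        max_eq_left (sub_nonneg.2 (hmono (by omega : j ≤ k + 1))), scalePoint_succ]
      simp only [Complex.real_smul]; push_cast; ring
    · intro j _ hj
      have hj' : k + 1 ≤ j := by simpa using hj
      rw [max_eq_right (sub_nonpos.2 (hmono hj')),
        max_eq_right (sub_nonpos.2 (hmono (by omega : k ≤ j)))]
      simp
  rw [hφ, stringSol_eq, stringSol_eq _ z (scalePoint U k), ← hφ,
    max_eq_left (scalePoint_nonneg hU _), max_eq_left (scalePoint_nonneg hU _)]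
  have h1 : ((scalePoint U (k + 1) : ℝ) : ℂ) = scalePoint U k + U (k + 1) := by
    rw [scalePoint_succ]; push_cast; rfl
  linear_combination h1 - z * key

lemma stringSol_scalePoint_zero (n : ℕ) (z : ℂ) :
    stringSol (speedMeasure U H n) z (scalePoint U 0) = 0 :=
  stringSol_of_nonpos _ _ (scalePoint_zero U).le

lemma stringSol_scalePoint_one (hU : ∀ x, 0 < U x) (hH : ∀ x, 0 < H x) {n : ℕ} (hn : 1 ≤ n)
    (z : ℂ) : stringSol (speedMeasure U H n) z (scalePoint U 1) = U 1 := by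
  have := stringSol_scalePoint_succ_sub hU hH (k := 0) (by omega : 0 < n) z
  simpa [stringSol_scalePoint_zero] using this

lemma isStringSeq_stringSol (hU : ∀ x, 0 < U x) (hH : ∀ x, 0 < H x) (n : ℕ) (z : ℂ) :
    IsStringSeq U H n z fun k => stringSol (speedMeasure U H n) z (scalePoint U k) := by
  intro k hk
  have h1 := stringSol_scalePoint_succ_sub hU hH hk z
  have h2 := stringSol_scalePoint_succ_sub hU hH (by omega : k < n) z
  have e1 : (U (k + 1) : ℂ) ≠ 0 := Complex.ofReal_ne_zero.2 (hU _).ne'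
  have e2 : (U (k + 2) : ℂ) ≠ 0 := Complex.ofReal_ne_zero.2 (hU _).ne'
  have e3 : (((k + 1 : ℕ) : ℤ) + 1) = (k : ℤ) + 2 := by push_cast; ring
  rw [e3] at h1
  simp only
  rw [h1, h2, mul_div_cancel_left₀ _ e1, mul_div_cancel_left₀ _ e2, Finset.sum_range_succ _ (k + 1)]
  push_cast; ring

/-- The second-order recurrence is determined by its values at `0` and `1`, where the sampled
solution takes the values `0` and `U 1`. -/
lemma IsStringSeq.eq_stringSol (hU : ∀ x, 0 < U x) (hH : ∀ x, 0 < H x) {n : ℕ} (hn : 1 ≤ n)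
    {z : ℂ} {f : ℕ → ℂ} (hf : IsStringSeq U H n z f) (hf0 : f 0 = 0) {k : ℕ} (hk : k ≤ n) :
    f k = f 1 / U 1 * stringSol (speedMeasure U H n) z (scalePoint U k) := by
  have e1 : (U 1 : ℂ) ≠ 0 := Complex.ofReal_ne_zero.2 (hU _).ne'
  set φ : ℕ → ℂ := fun k => stringSol (speedMeasure U H n) z (scalePoint U k) with hφ
  have hφs : IsStringSeq U H n z φ := isStringSeq_stringSol hU hH n z
  have hφ0 : φ 0 = 0 := stringSol_scalePoint_zero n z
  have hφ1 : φ 1 = U 1 := stringSol_scalePoint_one hU hH hn z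
  have key : ∀ k, k + 1 ≤ n → f k = f 1 / U 1 * φ k ∧ f (k + 1) = f 1 / U 1 * φ (k + 1) := by
    intro k
    induction k with
    | zero =>
      intro _
      refine ⟨by rw [hf0, hφ0, mul_zero], ?_⟩
      rw [zero_add, hφ1]; field_simp
    | succ k ih =>
      intro hk
      obtain ⟨h1, h2⟩ := ih (by omega)
      refine ⟨h2, ?_⟩
      have e2 : (U (k + 1) : ℂ) ≠ 0 := Complex.ofReal_ne_zero.2 (hU _).ne'
      have e3 : (U (k + 2) : ℂ) ≠ 0 := Complex.ofReal_ne_zero.2 (hU _).ne'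
      have a1 := hf k hk
      have a2 := hφs k hk
      have a3 : f (k + 2) = f (k + 1) + U (k + 2) * ((f (k + 1) - f k) / U (k + 1)
          - z * H (k + 1) * f (k + 1)) := by
        rw [div_eq_iff e3 |>.1 (sub_eq_iff_eq_add.1 a1) |> sub_eq_iff_eq_add.1]; ring
      have a4 : φ (k + 2) = φ (k + 1) + U (k + 2) * ((φ (k + 1) - φ k) / U (k + 1)
          - z * H (k + 1) * φ (k + 1)) := by
        rw [div_eq_iff e3 |>.1 (sub_eq_iff_eq_add.1 a2) |> sub_eq_iff_eq_add.1]; ring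
      rw [show k + 1 + 1 = k + 2 from rfl, a3, a4, h1, h2]
      ring
  rcases Nat.eq_zero_or_pos k with rfl | hk0
  · rw [hf0]; change 0 = _ * φ 0; rw [hφ0, mul_zero]
  · obtain ⟨j, rfl⟩ := Nat.exists_eq_add_of_le' hk0
    exact (key j hk).2

end Discrete

section Walk

variable {U H : ℤ → ℝ} {c : ℤ → ℤ → ℝ} {n : ℕ}

/-- The values of an element of the walk space, indexed by natural numbers. -/
noncomputable def walkSeq (f : walkSpace n) (k : ℕ) : ℂ :=
  if h : k ≤ n then f.1 ⟨k, by constructor <;> omega⟩ else 0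

lemma walkSeq_zero (f : walkSpace n) : walkSeq f 0 = 0 := by
  simpa [walkSeq] using f.2.1

lemma walkSeq_self (f : walkSpace n) : walkSeq f n = 0 := by
  simpa [walkSeq] using f.2.2

lemma walkSeq_toNat (f : walkSpace n) (k : Set.Icc (0 : ℤ) n) : f.1 k = walkSeq f k.1.toNat := by
  obtain ⟨k, h0, h1⟩ := k
  lift k to ℕ using h0
  have : k ≤ n := by exact_mod_cast h1
  simp [walkSeq, this]

/-- The factorization of the rates makes the generator, at interior points, a difference of slopes
divided by `H`. At the two endpoints both sides of the eigenvalue equation vanish. -/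
lemma mem_eigenspace_walkGenerator (hc : IsScaleSpeedPair c U H) (z : ℂ) (f : walkSpace n) :
    f ∈ Module.End.eigenspace (-walkGenerator c n) z ↔ IsStringSeq U H n z (walkSeq f) := by
  obtain ⟨hU, hH, hcUH⟩ := hc
  have hval : ∀ k : ℕ, ∀ hk : k + 1 < n,
      (walkGenerator c n f).1 ⟨(k + 1 : ℕ), by constructor <;> omega⟩ =
        ((walkSeq f (k + 2) - walkSeq f (k + 1)) / U (k + 2) -
          (walkSeq f (k + 1) - walkSeq f k) / U (k + 1)) / H (k + 1) := by
    intro k hk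
    have e1 : (U (k + 1) : ℂ) ≠ 0 := Complex.ofReal_ne_zero.2 (hU _).ne'
    have e2 : (U (k + 2) : ℂ) ≠ 0 := Complex.ofReal_ne_zero.2 (hU _).ne'
    have e3 : (H (k + 1) : ℂ) ≠ 0 := Complex.ofReal_ne_zero.2 (hH _).ne'
    have c1 : c (k + 1) (k + 1 - 1) = 1 / (H (k + 1) * U (k + 1)) := by
      rw [hcUH _ _ (by simp), max_eq_left (by omega)]
    have c2 : c (k + 1) (k + 1 + 1) = 1 / (H (k + 1) * U (k + 2)) := by
      rw [hcUH _ _ (by simp), max_eq_right (by omega), add_assoc]; rfl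
    have hcond : 0 < ((k + 1 : ℕ) : ℤ) ∧ ((k + 1 : ℕ) : ℤ) < n := by omega
    have hgen : (walkGenerator c n f).1 ⟨(k + 1 : ℕ), by constructor <;> omega⟩ =
        (c (k + 1 : ℕ) ((k + 1 : ℕ) - 1) : ℂ) *
          (f.1 ⟨(k + 1 : ℕ) - 1, by constructor <;> omega⟩ -
            f.1 ⟨(k + 1 : ℕ), by constructor <;> omega⟩) +
        (c (k + 1 : ℕ) ((k + 1 : ℕ) + 1) : ℂ) *
          (f.1 ⟨(k + 1 : ℕ) + 1, by constructor <;> omega⟩ -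
            f.1 ⟨(k + 1 : ℕ), by constructor <;> omega⟩) := dif_pos hcond
    rw [hgen]
    simp only [walkSeq_toNat]
    have t1 : (((k + 1 : ℕ) : ℤ) - 1).toNat = k := by omega
    have t2 : (((k + 1 : ℕ) : ℤ) + 1).toNat = k + 2 := by omega
    have t3 : (((k + 1 : ℕ) : ℤ)).toNat = k + 1 := by omega
    rw [t1, t2, t3]
    push_cast
    rw [c1, c2]
    push_cast
    field_simp
    ring
  rw [Module.End.mem_eigenspace_iff]
  constructor
  · intro h k hk
    have e3 : (H (k + 1) : ℂ) ≠ 0 := Complex.ofReal_ne_zero.2 (hH _).ne'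
    have h1 := congrFun (congrArg Subtype.val h) ⟨(k + 1 : ℕ), by constructor <;> omega⟩
    simp only [LinearMap.neg_apply, Submodule.coe_neg, Pi.neg_apply, Submodule.coe_smul,
      Pi.smul_apply, smul_eq_mul] at h1
    rw [hval k hk, walkSeq_toNat, neg_eq_iff_eq_neg, div_eq_iff e3] at h1
    rw [h1]
    simp only [Int.toNat_natCast]
    ring
  · intro h
    ext k
    simp only [LinearMap.neg_apply, Submodule.coe_neg, Pi.neg_apply, Submodule.coe_smul,
      Pi.smul_apply, smul_eq_mul]
    obtain ⟨k, h0, h1⟩ := k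
    lift k to ℕ using h0
    by_cases hk : 0 < k ∧ k < n
    · obtain ⟨j, rfl⟩ := Nat.exists_eq_add_of_le' hk.1
      have e3 : (H (j + 1) : ℂ) ≠ 0 := Complex.ofReal_ne_zero.2 (hH _).ne'
      rw [hval j hk.2, h j hk.2, walkSeq_toNat]
      simp only [Int.toNat_natCast]
      field_simp
    · have hcond : ¬ (0 < (k : ℤ) ∧ (k : ℤ) < n) := by omega
      have hz : (walkGenerator c n f).1 ⟨k, h0, h1⟩ = 0 := by
        simp only [walkGenerator, LinearMap.coe_mk, AddHom.coe_mk, dif_neg hcond]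
      rw [hz, walkSeq_toNat]
      simp only [Int.toNat_natCast]
      have : k = 0 ∨ k = n := by omega
      rcases this with rfl | rfl
      · rw [walkSeq_zero]; simp
      · rw [walkSeq_self]; simp

/-- The restriction of the solution of the initial value problem to the walk space. -/
noncomputable def walkSol (U H : ℤ → ℝ) (n : ℕ) (z : ℂ)
    (hz : stringSol (speedMeasure U H n) z (scalePoint U n) = 0) : walkSpace n :=
  ⟨fun k => stringSol (speedMeasure U H n) z (scalePoint U k.1.toNat),
    by simpa using stringSol_scalePoint_zero n z, by simpa using hz⟩

lemma walkSeq_walkSol {z : ℂ} (hz : stringSol (speedMeasure U H n) z (scalePoint U n) = 0) {k : ℕ}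
    (hk : k ≤ n) : walkSeq (walkSol U H n z hz) k =
      stringSol (speedMeasure U H n) z (scalePoint U k) := by
  simp [walkSeq, walkSol, hk]

lemma eigenspace_le_span (hc : IsScaleSpeedPair c U H) (hn : 1 ≤ n) {z : ℂ} {f : walkSpace n}
    (hf : f ∈ Module.End.eigenspace (-walkGenerator c n) z) (k : Set.Icc (0 : ℤ) n) :
    f.1 k = walkSeq f 1 / U 1 *
      stringSol (speedMeasure U H n) z (scalePoint U k.1.toNat) := by
  rw [walkSeq_toNat]
  exact ((mem_eigenspace_walkGenerator hc z f).1 hf).eq_stringSol hc.1 hc.2.1 hn (walkSeq_zero f)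
    (by have := k.2.2; omega)

lemma walkSol_mem_eigenspace (hc : IsScaleSpeedPair c U H) {z : ℂ}
    (hz : stringSol (speedMeasure U H n) z (scalePoint U n) = 0) :
    walkSol U H n z hz ∈ Module.End.eigenspace (-walkGenerator c n) z := by
  rw [mem_eigenspace_walkGenerator hc]
  intro k hk
  rw [walkSeq_walkSol hz (by omega), walkSeq_walkSol hz (by omega), walkSeq_walkSol hz (by omega)]
  exact isStringSeq_stringSol hc.1 hc.2.1 n z k hk

lemma walkSol_ne_zero (hc : IsScaleSpeedPair c U H) (hn : 1 ≤ n) {z : ℂ}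
    (hz : stringSol (speedMeasure U H n) z (scalePoint U n) = 0) : walkSol U H n z hz ≠ 0 := by
  intro h
  have h1 := walkSeq_walkSol hz hn
  rw [stringSol_scalePoint_one hc.1 hc.2.1 hn, h] at h1
  have h2 : walkSeq (0 : walkSpace n) 1 = 0 := by simp [walkSeq]
  rw [h2] at h1
  exact (hc.1 1).ne' (Complex.ofReal_eq_zero.1 h1.symm)

/-- The recurrence and the left boundary condition leave only multiples of the sampled solution; the
right boundary condition is the characteristic equation. -/
theorem hasEigenvalue_walkGenerator_iff (hc : IsScaleSpeedPair c U H) (hn : 1 ≤ n) (z : ℂ) :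
    Module.End.HasEigenvalue (-walkGenerator c n) z ↔
      stringSol (speedMeasure U H n) z (scalePoint U n) = 0 := by
  constructor
  · intro h
    obtain ⟨f, hf, hf0⟩ := h.exists_hasEigenvector
    have key := eigenspace_le_span hc hn hf
    have h1 := key ⟨n, by simp⟩
    rw [f.2.2] at h1
    refine (mul_eq_zero.1 h1.symm).resolve_left fun h0 => hf0 ?_
    ext k
    rw [key k, h0, zero_mul]; rfl
  · intro hz
    exact Module.End.hasEigenvalue_of_hasEigenvector (Module.End.hasEigenvector_iff.2
      ⟨walkSol_mem_eigenspace hc hz, walkSol_ne_zero hc hn hz⟩)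

theorem finrank_eigenspace_walkGenerator (hc : IsScaleSpeedPair c U H) (hn : 1 ≤ n) {z : ℂ}
    (hz : stringSol (speedMeasure U H n) z (scalePoint U n) = 0) :
    Module.finrank ℂ (Module.End.eigenspace (-walkGenerator c n) z) = 1 := by
  refine finrank_eq_one (⟨walkSol U H n z hz, walkSol_mem_eigenspace hc hz⟩ :
    Module.End.eigenspace (-walkGenerator c n) z) ?_ fun f => ?_
  · intro h
    exact walkSol_ne_zero hc hn hz (congrArg Subtype.val h)
  · refine ⟨walkSeq f.1 1 / U 1, ?_⟩
    ext k
    exact (eigenspace_le_span hc hn f.2 k).symm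

end Walk

/-! ### Min-max counting and the Jacobi matrix of the string. -/

section MinMax

variable {E : Type*} [NormedAddCommGroup E] [InnerProductSpace ℝ E] [FiniteDimensional ℝ E]
  {T : E →ₗ[ℝ] E} {N : ℕ}

lemma LinearMap.IsSymmetric.inner_eigenvectorBasis_apply (hT : T.IsSymmetric)
    (hN : Module.finrank ℝ E = N) (i : Fin N) (v : E) :
    inner ℝ (hT.eigenvectorBasis hN i) (T v) =
      hT.eigenvalues hN i * inner ℝ (hT.eigenvectorBasis hN i) v := by
  rw [← hT, hT.apply_eigenvectorBasis, inner_smul_left]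
  simp

/-- If the quadratic form of `T` is at most `C` on a `K`-dimensional space, then `T` has at least
`K` eigenvalues, counted with multiplicity, that are at most `C`. -/
theorem LinearMap.IsSymmetric.le_card_eigenvalues_le (hT : T.IsSymmetric)
    (hN : Module.finrank ℝ E = N) {K : ℕ} (L : (Fin K → ℝ) →ₗ[ℝ] E)
    (hL : Function.Injective L) {C : ℝ}
    (hC : ∀ a, inner ℝ (T (L a)) (L a) ≤ C * inner ℝ (L a) (L a)) :
    K ≤ (Finset.univ.filter fun i => hT.eigenvalues hN i ≤ C).card := by
  classical
  by_contra! hlt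
  set S := Finset.univ.filter fun i => hT.eigenvalues hN i ≤ C
  set b := hT.eigenvectorBasis hN with hb
  -- With fewer than `K` eigenvalues at most `C`, some nonzero vector of the image of `L` is
  -- orthogonal to all their eigenvectors, and its quadratic form strictly exceeds `C` times its
  -- squared norm.
  let P : (Fin K → ℝ) →ₗ[ℝ] (S → ℝ) :=
    LinearMap.pi fun i => (innerₗ E (b i.1)).comp L
  obtain ⟨a, haP, ha0⟩ := (Submodule.ne_bot_iff _).1
    (LinearMap.ker_ne_bot_of_finrank_lt (f := P) (by simpa using hlt))
  have hperp : ∀ i, hT.eigenvalues hN i ≤ C → inner ℝ (b i) (L a) = 0 := fun i hi =>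
    congrFun (LinearMap.mem_ker.1 haP) ⟨i, by simp [S, hi]⟩
  have hv : L a ≠ 0 := fun h => ha0 (hL (by rw [h, map_zero]))
  have h1 : inner ℝ (T (L a)) (L a) =
      ∑ i, hT.eigenvalues hN i * (inner ℝ (b i) (L a)) ^ 2 := by
    rw [← b.sum_inner_mul_inner]
    refine Finset.sum_congr rfl fun i _ => ?_
    rw [real_inner_comm, hT.inner_eigenvectorBasis_apply hN i]; ring
  have h2 : inner ℝ (L a) (L a) = ∑ i, (inner ℝ (b i) (L a)) ^ 2 := by
    rw [← b.sum_inner_mul_inner]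
    refine Finset.sum_congr rfl fun i _ => ?_
    rw [real_inner_comm]; ring
  obtain ⟨j, hj⟩ : ∃ j, inner ℝ (b j) (L a) ≠ 0 := by
    by_contra! hcon
    refine hv (b.repr.map_eq_zero_iff.1 ?_)
    ext i
    rw [OrthonormalBasis.repr_apply_apply, hcon i]; rfl
  have h3 : C * inner ℝ (L a) (L a) < inner ℝ (T (L a)) (L a) := by
    rw [h1, h2, Finset.mul_sum]
    refine Finset.sum_lt_sum (fun i _ => ?_) ⟨j, Finset.mem_univ _, ?_⟩
    · by_cases hi : hT.eigenvalues hN i ≤ C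
      · rw [hperp i hi]; simp
      · exact mul_le_mul_of_nonneg_right (not_le.1 hi).le (sq_nonneg _)
    · exact mul_lt_mul_of_pos_right (not_le.1 fun h => hj (hperp j h)) (by positivity)
  exact absurd (hC a) (not_le.2 h3)

end MinMax

section Jacobi

variable (U H : ℤ → ℝ) (N : ℕ)

/-- Extension by zero of `i ↦ g i / √H(i+1)` to all indices. -/
noncomputable def jacobiExt : EuclideanSpace ℝ (Fin N) →ₗ[ℝ] (ℕ → ℝ) where
  toFun g k := if h : 1 ≤ k ∧ k ≤ N then g ⟨k - 1, by omega⟩ / √(H k) else 0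
  map_add' f g := by
    ext k
    by_cases h : 1 ≤ k ∧ k ≤ N
    · simp [h, add_div]
    · simp [h]
  map_smul' a g := by
    ext k
    by_cases h : 1 ≤ k ∧ k ≤ N
    · simp [h, mul_div_assoc]
    · simp [h]

lemma jacobiExt_succ (g : EuclideanSpace ℝ (Fin N)) (i : Fin N) :
    jacobiExt H N g (i + 1) = g i / √(H (i + 1)) := by
  have : 1 ≤ (i : ℕ) + 1 ∧ (i : ℕ) + 1 ≤ N := by omega
  simp [jacobiExt, this]

lemma jacobiExt_zero (g : EuclideanSpace ℝ (Fin N)) : jacobiExt H N g 0 = 0 := by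
  simp [jacobiExt]

lemma jacobiExt_of_lt (g : EuclideanSpace ℝ (Fin N)) {k : ℕ} (hk : N < k) :
    jacobiExt H N g k = 0 := by
  have : ¬ (1 ≤ k ∧ k ≤ N) := by omega
  simp [jacobiExt, this]

/-- Difference quotients. -/
noncomputable def scaleSlope (f : ℕ → ℝ) (k : ℕ) : ℝ := (f (k + 1) - f k) / U (k + 1)

/-- The Jacobi matrix of the string, as an operator on Euclidean space. -/
noncomputable def jacobi : EuclideanSpace ℝ (Fin N) →ₗ[ℝ] EuclideanSpace ℝ (Fin N) where
  toFun g := WithLp.toLp 2 fun i => (scaleSlope U (jacobiExt H N g) i -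
    scaleSlope U (jacobiExt H N g) (i + 1)) / √(H (i + 1))
  map_add' f g := by
    ext i
    simp only [scaleSlope, map_add, Pi.add_apply, PiLp.add_apply]
    ring
  map_smul' a g := by
    ext i
    simp only [scaleSlope, map_smul, Pi.smul_apply, PiLp.smul_apply, smul_eq_mul, RingHom.id_apply]
    ring

lemma jacobi_apply (g : EuclideanSpace ℝ (Fin N)) (i : Fin N) :
    jacobi U H N g i = (scaleSlope U (jacobiExt H N g) i -
      scaleSlope U (jacobiExt H N g) (i + 1)) / √(H (i + 1)) := rfl

lemma sum_by_parts (d f : ℕ → ℝ) (N : ℕ) :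
    ∑ i ∈ Finset.range N, (d i - d (i + 1)) * f (i + 1) =
      ∑ k ∈ Finset.range (N + 1), d k * (f (k + 1) - f k) + d 0 * f 0 - d N * f (N + 1) := by
  induction N with
  | zero => simp; ring
  | succ N ih => rw [Finset.sum_range_succ, ih, Finset.sum_range_succ _ (N + 1)]; ring

/-- Summation by parts, with no boundary terms because the extension vanishes at `0` and `N + 1`.
The energy form is visibly symmetric and becomes the numerator of the Rayleigh quotient. -/
lemma inner_jacobi (g g' : EuclideanSpace ℝ (Fin N)) :
    inner ℝ (jacobi U H N g) g' = ∑ k ∈ Finset.range (N + 1),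
      (jacobiExt H N g (k + 1) - jacobiExt H N g k) *
        (jacobiExt H N g' (k + 1) - jacobiExt H N g' k) / U (k + 1) := by
  have h := sum_by_parts (scaleSlope U (jacobiExt H N g)) (jacobiExt H N g') N
  rw [jacobiExt_zero, jacobiExt_of_lt H N g' (Nat.lt_succ_self N), mul_zero, mul_zero, add_zero,
    sub_zero, Finset.sum_range] at h
  rw [PiLp.inner_apply]
  refine Eq.trans (Finset.sum_congr rfl fun i _ => ?_) (h.trans (Finset.sum_congr rfl fun k _ => ?_))
  · rw [jacobiExt_succ]
    simp only [jacobi_apply, RCLike.inner_apply, conj_trivial]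
    ring
  · rw [scaleSlope]; ring

lemma isSymmetric_jacobi : (jacobi U H N).IsSymmetric := fun g g' => by
  rw [inner_jacobi, real_inner_comm, inner_jacobi]
  exact Finset.sum_congr rfl fun k _ => by ring

variable {U H N}

/-- The factor `√H` in the coordinates turns the weighted norm with weights `H` into the Euclidean
one, so that the symmetric spectral theorem applies. -/
lemma inner_self_eq_sum_jacobiExt (hH : ∀ x, 0 < H x) (g : EuclideanSpace ℝ (Fin N)) :
    inner ℝ g g = ∑ k ∈ Finset.range (N + 2), H (k : ℤ) * jacobiExt H N g k ^ 2 := by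
  rw [Finset.sum_range_succ, jacobiExt_of_lt H N g (Nat.lt_succ_self N), Finset.sum_range_succ',
    jacobiExt_zero, Finset.sum_range, PiLp.inner_apply]
  simp only [ne_eq, OfNat.ofNat_ne_zero, not_false_eq_true, zero_pow, mul_zero, add_zero]
  refine Finset.sum_congr rfl fun i _ => ?_
  rw [jacobiExt_succ, div_pow, Real.sq_sqrt (hH _).le]
  have := (hH (i + 1)).ne'
  simp only [RCLike.inner_apply, conj_trivial]
  push_cast
  field_simp

lemma exists_jacobiExt_eq (hH : ∀ x, 0 < H x) {f : ℕ → ℝ} (hf0 : f 0 = 0)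
    (hfN : f (N + 1) = 0) : ∀ k ≤ N + 1,
      jacobiExt H N (WithLp.toLp 2 fun i : Fin N => √(H (i + 1)) * f (i + 1)) k = f k := by
  intro k hk
  rcases Nat.eq_zero_or_pos k with rfl | hk0
  · rw [jacobiExt_zero, hf0]
  obtain ⟨j, rfl⟩ := Nat.exists_eq_add_of_le' hk0
  rcases Nat.lt_or_ge j N with hj | hj
  · have := jacobiExt_succ H N (WithLp.toLp 2 fun i : Fin N => √(H (i + 1)) * f (i + 1)) ⟨j, hj⟩
    refine this.trans ?_
    have := (Real.sqrt_pos.2 (hH (j + 1))).ne'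
    simp only
    field_simp
  · obtain rfl : j = N := by omega
    rw [jacobiExt_of_lt H _ _ (Nat.lt_succ_self _), hfN]

lemma jacobi_eq_smul_iff (hH : ∀ x, 0 < H x) (t : ℝ) (g : EuclideanSpace ℝ (Fin N)) :
    jacobi U H N g = t • g ↔ IsStringSeq U H (N + 1) t fun k => (jacobiExt H N g k : ℂ) := by
  have key : ∀ i : Fin N, jacobi U H N g i = t * g i ↔
      ((jacobiExt H N g (i + 2) : ℂ) - jacobiExt H N g (i + 1)) / U (i + 2) -
        ((jacobiExt H N g (i + 1) : ℂ) - jacobiExt H N g i) / U (i + 1) =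
        -t * H (i + 1) * jacobiExt H N g (i + 1) := by
    intro i
    have hs := Real.sqrt_pos.2 (hH (i + 1))
    have hgi : g i = √(H (i + 1)) * jacobiExt H N g (i + 1) := by
      rw [jacobiExt_succ]; field_simp
    have hsq := Real.mul_self_sqrt (hH (i + 1)).le
    rw [jacobi_apply, div_eq_iff hs.ne', hgi]
    have e : (((i : ℕ) + 1 : ℕ) : ℤ) + 1 = (i : ℤ) + 2 := by push_cast; ring
    simp only [scaleSlope, e]
    rw [show t * (√(H (i + 1)) * jacobiExt H N g (i + 1)) * √(H (i + 1)) =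
      t * H (i + 1) * jacobiExt H N g (i + 1) by
        linear_combination t * jacobiExt H N g (i + 1) * hsq]
    constructor
    · intro h
      have : (jacobiExt H N g (i + 2) - jacobiExt H N g (i + 1)) / U (i + 2) -
        (jacobiExt H N g (i + 1) - jacobiExt H N g i) / U (i + 1) =
        -t * H (i + 1) * jacobiExt H N g (i + 1) := by linarith
      exact_mod_cast congrArg (fun x : ℝ => (x : ℂ)) this
    · intro h
      have : (jacobiExt H N g (i + 2) - jacobiExt H N g (i + 1)) / U (i + 2) -
        (jacobiExt H N g (i + 1) - jacobiExt H N g i) / U (i + 1) =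
        -t * H (i + 1) * jacobiExt H N g (i + 1) := by exact_mod_cast h
      linarith
  constructor
  · intro h k hk
    exact (key ⟨k, by omega⟩).1 (congrArg (fun v : EuclideanSpace ℝ (Fin N) => v ⟨k, by omega⟩) h)
  · intro h
    ext i
    exact (key i).2 (h i (by omega))

lemma jacobiExt_eigenvector (hU : ∀ x, 0 < U x) (hH : ∀ x, 0 < H x) {t : ℝ}
    {g : EuclideanSpace ℝ (Fin N)} (hg : jacobi U H N g = t • g) (hg0 : g ≠ 0) :
    ∃ b : ℝ, b ≠ 0 ∧ realSol (speedMeasure U H (N + 1)) t (scalePoint U (N + 1)) = 0 ∧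
      ∀ i : Fin N, g i = b * (√(H (i + 1)) *
        realSol (speedMeasure U H (N + 1)) t (scalePoint U (i + 1))) := by
  have hs := (jacobi_eq_smul_iff hH t g).1 hg
  set b := jacobiExt H N g 1 / U 1 with hb
  have key : ∀ k ≤ N + 1, jacobiExt H N g k =
      b * realSol (speedMeasure U H (N + 1)) t (scalePoint U k) := by
    intro k hk
    have := hs.eq_stringSol hU hH (by omega) (by simp [jacobiExt_zero]) hk
    rw [← ofReal_realSol] at this
    exact_mod_cast this
  have hgi : ∀ i : Fin N, g i = b * (√(H (i + 1)) *
        realSol (speedMeasure U H (N + 1)) t (scalePoint U (i + 1))) := by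
    intro i
    have h1 := key (i + 1) (by omega)
    rw [jacobiExt_succ, div_eq_iff (Real.sqrt_pos.2 (hH _)).ne'] at h1
    rw [h1]; ring
  have hb0 : b ≠ 0 := by
    intro h0
    refine hg0 ?_
    ext i
    rw [hgi i, h0, zero_mul]; rfl
  refine ⟨b, hb0, ?_, hgi⟩
  have := key (N + 1) le_rfl
  rw [jacobiExt_of_lt H N g (Nat.lt_succ_self N)] at this
  exact (mul_eq_zero.1 this.symm).resolve_left hb0

/-- The Dirichlet spectrum of the discrete string: it has `N` points, and many of them are small if
there are many test functions with small energy. -/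
theorem exists_discrete_spectrum (hU : ∀ x, 0 < U x) (hH : ∀ x, 0 < H x) :
    ∃ s : Finset ℝ, s.card = N ∧
      (∀ t, t ∈ s ↔ realSol (speedMeasure U H (N + 1)) t (scalePoint U (N + 1)) = 0) ∧
      ∀ (K : ℕ) (C : ℝ) (f : Fin K → ℕ → ℝ), (∀ i, f i 0 = 0) → (∀ i, f i (N + 1) = 0) →
        (∀ a : Fin K → ℝ, a ≠ 0 →
          0 < ∑ k ∈ Finset.range (N + 2), H (k : ℤ) * (∑ i, a i * f i k) ^ 2) →
        (∀ a : Fin K → ℝ, ∑ k ∈ Finset.range (N + 1),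
          (∑ i, a i * f i (k + 1) - ∑ i, a i * f i k) ^ 2 / U (k + 1) ≤
            C * ∑ k ∈ Finset.range (N + 2), H (k : ℤ) * (∑ i, a i * f i k) ^ 2) →
        K ≤ (s.filter (· ≤ C)).card := by
  classical
  have hT := isSymmetric_jacobi U H N
  have hN : Module.finrank ℝ (EuclideanSpace ℝ (Fin N)) = N := by simp
  set e := hT.eigenvalues hN with he
  set v := hT.eigenvectorBasis hN with hv
  have hev : ∀ i, jacobi U H N (v i) = e i • v i := fun i => hT.apply_eigenvectorBasis hN i
  have hv0 : ∀ i, v i ≠ 0 := fun i => v.orthonormal.ne_zero i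
  -- Eigenvectors with the same eigenvalue are multiples of one sampled solution, which two distinct
  -- members of an orthonormal basis cannot be.
  have hinj : Function.Injective e := by
    intro i j hij
    by_contra hne
    obtain ⟨b, hb, -, hb'⟩ := jacobiExt_eigenvector hU hH (hev i) (hv0 i)
    obtain ⟨b', hb0, -, hb0'⟩ := jacobiExt_eigenvector hU hH (hev j) (hv0 j)
    have h1 : b' • v i = b • v j := by
      ext k
      simp only [PiLp.smul_apply, smul_eq_mul]
      rw [hb' k, hb0' k, hij]; ring
    have h2 := congrArg (inner ℝ (v i)) h1
    rw [inner_smul_right, inner_smul_right, v.inner_eq_zero hne, mul_zero, v.inner_eq_one,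
      mul_one] at h2
    exact hb0 h2
  refine ⟨Finset.univ.image e, ?_, fun t => ⟨fun ht => ?_, fun ht => ?_⟩, ?_⟩
  · rw [Finset.card_image_of_injective _ hinj, Finset.card_univ, Fintype.card_fin]
  · obtain ⟨i, -, rfl⟩ := Finset.mem_image.1 ht
    obtain ⟨b, -, h, -⟩ := jacobiExt_eigenvector hU hH (hev i) (hv0 i)
    exact h
  · set f : ℕ → ℝ := fun k => realSol (speedMeasure U H (N + 1)) t (scalePoint U k) with hf
    have hf0 : f 0 = 0 := (realSol_eq_zero_iff _ _ _).2 (stringSol_scalePoint_zero _ _)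
    have hext := exists_jacobiExt_eq hH hf0 ht
    set g : EuclideanSpace ℝ (Fin N) := WithLp.toLp 2 fun i : Fin N => √(H (i + 1)) * f (i + 1)
    have hf1 : f 1 = U 1 := by
      have := stringSol_scalePoint_one hU hH (n := N + 1) (by omega) t
      rw [← ofReal_realSol] at this
      exact_mod_cast this
    have hg0 : g ≠ 0 := by
      intro h
      have := hext 1 (by omega)
      rw [h, map_zero, hf1] at this
      exact (hU 1).ne this
    have hg : jacobi U H N g = t • g := by
      rw [jacobi_eq_smul_iff hH]
      intro k hk
      simp only
      rw [hext _ (by omega), hext _ (by omega), hext _ (by omega)]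
      simp only [hf, ofReal_realSol]
      exact isStringSeq_stringSol hU hH (N + 1) t k hk
    obtain ⟨i, hi⟩ := hT.exists_eigenvalues_eq hN
      (Module.End.hasEigenvalue_of_hasEigenvector (Module.End.hasEigenvector_iff.2
        ⟨Module.End.mem_eigenspace_iff.2 hg, hg0⟩))
    exact Finset.mem_image.2 ⟨i, Finset.mem_univ _, hi⟩
  · intro K C f hf0 hfN hpos hC
    rw [Finset.filter_image, Finset.card_image_of_injective _ hinj]
    let L : (Fin K → ℝ) →ₗ[ℝ] EuclideanSpace ℝ (Fin N) :=
      { toFun := fun a => WithLp.toLp 2 fun i : Fin N => √(H (i + 1)) * ∑ j, a j * f j (i + 1)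
        map_add' := fun a b => by
          ext i
          simp only [Pi.add_apply, add_mul, Finset.sum_add_distrib, PiLp.add_apply]; ring
        map_smul' := fun c a => by
          ext i
          simp only [Pi.smul_apply, smul_eq_mul, mul_assoc, ← Finset.mul_sum, PiLp.smul_apply,
            RingHom.id_apply]; ring }
    have hLext : ∀ a, ∀ k ≤ N + 1, jacobiExt H N (L a) k = ∑ j, a j * f j k := fun a =>
      exists_jacobiExt_eq hH (f := fun k => ∑ j, a j * f j k) (by simp [hf0]) (by simp [hfN])
    have hLL : ∀ a, inner ℝ (L a) (L a) =
        ∑ k ∈ Finset.range (N + 2), H (k : ℤ) * (∑ i, a i * f i k) ^ 2 := fun a => by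
      rw [inner_self_eq_sum_jacobiExt hH]
      refine Finset.sum_congr rfl fun k hk => ?_
      rw [hLext a k (by simp at hk; omega)]
    refine hT.le_card_eigenvalues_le hN L ?_ fun a => ?_
    · rw [← LinearMap.ker_eq_bot, LinearMap.ker_eq_bot']
      intro a ha
      by_contra hne
      have := hpos a hne
      rw [← hLL, ha, inner_zero_left] at this
      exact this.ne rfl
    · rw [hLL, inner_jacobi]
      refine le_trans (le_of_eq (Finset.sum_congr rfl fun k hk => ?_)) (hC a)
      have : k < N + 1 := by simpa using hk
      rw [hLext a k (by omega), hLext a (k + 1) (by omega)]; ring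

end Jacobi

/-! ### Points of increase, hat functions and the bound on low eigenvalues. -/

section GrowthSet

variable {m : StieltjesFunction ℝ}

/-- Around each point of the complement `m` is constant on an interval, so the complement is locally
null and hence null. -/
lemma measure_compl_growthSet (hm : ∀ x : ℝ, x < 0 → m x = 0) :
    m.measure (growthSet m)ᶜ = 0 := by
  have key : ∀ x ε : ℝ, 0 < ε → m (x + ε) ≤ m (x - ε) →
      ∃ u ∈ 𝓝[(growthSet m)ᶜ] x, m.measure u = 0 := by
    intro x ε hε h
    refine ⟨Set.Ioc (x - ε) (x + ε), mem_nhdsWithin_of_mem_nhds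
      (Ioc_mem_nhds (by linarith) (by linarith)), ?_⟩
    rw [StieltjesFunction.measure_Ioc, ENNReal.ofReal_eq_zero]
    linarith
  refine measure_null_of_locally_null _ fun x hx => ?_
  rcases lt_or_ge x 0 with h0 | h0
  · exact key x (-x / 2) (by linarith) (by rw [hm _ (by linarith), hm _ (by linarith)])
  · have : ∃ ε : ℝ, 0 < ε ∧ m (x + ε) ≤ m (x - ε) := by
      by_contra! hcon
      exact hx ⟨h0, hcon⟩
    obtain ⟨ε, hε, h⟩ := this
    exact key x ε hε h

lemma measure_compl_Icc (hm : ∀ x : ℝ, x < 0 → m x = 0) {ℓ : ℝ}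
    (hsup : ℓ ∈ upperBounds (growthSet m)) : m.measure (Set.Icc 0 ℓ)ᶜ = 0 :=
  measure_mono_null (Set.compl_subset_compl.2 fun _ hx => ⟨hx.1, hsup hx⟩)
    (measure_compl_growthSet hm)

lemma isFiniteMeasure_of_compl_Icc {μ : Measure ℝ} [IsLocallyFiniteMeasure μ] {a b : ℝ}
    (h : μ (Set.Icc a b)ᶜ = 0) : IsFiniteMeasure μ :=
  ⟨by
    rw [← measure_add_measure_compl measurableSet_Icc, h, add_zero]
    exact isCompact_Icc.measure_lt_top⟩

lemma measure_ball_pos_of_mem_growthSet {x r : ℝ} (hx : x ∈ growthSet m) (hr : 0 < r) :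
    0 < m.measure (Set.Ioo (x - r) (x + r)) := by
  have h : 0 < m.measure (Set.Ioc (x - r / 2) (x + r / 2)) := by
    rw [StieltjesFunction.measure_Ioc, ENNReal.ofReal_pos]
    linarith [hx.2 (r / 2) (by linarith)]
  refine h.trans_le (measure_mono fun y hy => ⟨by linarith [hy.1], by linarith [hy.2]⟩)

lemma eq_sum_dirac_of_finite {μ : Measure ℝ} [IsFiniteMeasure μ] (s : Finset ℝ)
    (h : μ (s : Set ℝ)ᶜ = 0) :
    μ = ∑ x ∈ s, (μ {x}).toNNReal • Measure.dirac x := by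
  classical
  ext A hA
  rw [Measure.coe_finsetSum, Finset.sum_apply]
  have h1 : μ A = μ (s.filter (· ∈ A) : Finset ℝ) := by
    have hae : ∀ᵐ x ∂μ, x ∈ (s : Set ℝ) := h
    refine measure_congr (hae.mono fun x hx => ?_)
    have hx' : x ∈ s := hx
    exact propext ⟨fun hxA => by
      change x ∈ ((s.filter (· ∈ A) : Finset ℝ) : Set ℝ)
      simp only [Finset.coe_filter, Set.mem_ofPred_eq]
      exact ⟨hx', hxA⟩, fun hxA => by
      change x ∈ ((s.filter (· ∈ A) : Finset ℝ) : Set ℝ) at hxA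
      simp only [Finset.coe_filter, Set.mem_ofPred_eq] at hxA
      exact hxA.2⟩
  rw [h1, ← sum_measure_singleton, Finset.sum_filter]
  refine Finset.sum_congr rfl fun x _ => ?_
  rw [Measure.smul_apply, Measure.dirac_apply' _ hA]
  by_cases hx : x ∈ A
  · simp [hx, ENNReal.smul_def]
  · simp [hx]

/-- A finite set of full measure would exhibit `dm` as a finite combination of Dirac measures. -/
lemma infinite_growthSet (hm : ∀ x : ℝ, x < 0 → m x = 0) [IsFiniteMeasure m.measure]
    (hdelta : ¬ ∃ (s : Finset ℝ) (w : ℝ → NNReal),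
      m.measure = ∑ x ∈ s, w x • Measure.dirac x) : (growthSet m).Infinite := by
  intro hfin
  refine hdelta ⟨hfin.toFinset, _, eq_sum_dirac_of_finite hfin.toFinset ?_⟩
  rw [hfin.coe_toFinset]
  exact measure_compl_growthSet hm

end GrowthSet

/-- The hat function of height and radius `r` centred at `c`. -/
def hat (r c x : ℝ) : ℝ := max (r - |x - c|) 0

lemma continuous_hat (r c : ℝ) : Continuous (hat r c) := by unfold hat; fun_prop

lemma hat_eq_zero {r c x : ℝ} (h : r ≤ |x - c|) : hat r c x = 0 := max_eq_right (by linarith)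

lemma abs_hat_sub_le (r c x y : ℝ) : |hat r c x - hat r c y| ≤ |x - y| := by
  refine (abs_max_sub_max_le_abs _ _ 0).trans ?_
  rw [sub_sub_sub_cancel_left, abs_sub_comm x y]
  refine (abs_abs_sub_abs_le_abs_sub _ _).trans (le_of_eq ?_)
  congr 1; ring

lemma norm_hat_sq_le (r c x : ℝ) : ‖hat r c x ^ 2‖ ≤ |r| ^ 2 := by
  have h0 : 0 ≤ hat r c x := le_max_right _ _
  have h1 : hat r c x ≤ |r| :=
    max_le ((sub_le_self _ (abs_nonneg _)).trans (le_abs_self r)) (abs_nonneg r)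
  rw [Real.norm_eq_abs, abs_of_nonneg (by positivity)]
  gcongr

lemma integral_hat_sq_pos {μ : Measure ℝ} [IsFiniteMeasure μ] {r c : ℝ}
    (h : 0 < μ (Set.Ioo (c - r) (c + r))) : 0 < ∫ x, hat r c x ^ 2 ∂μ := by
  rw [integral_pos_iff_support_of_nonneg (fun x => sq_nonneg _)
    (Integrable.of_bound ((continuous_hat r c).pow 2).aestronglyMeasurable _
      (.of_forall (norm_hat_sq_le r c)))]
  refine h.trans_le (measure_mono fun x hx => ?_)
  have : |x - c| < r := abs_lt.2 ⟨by linarith [hx.1], by linarith [hx.2]⟩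
  have : 0 < hat r c x := lt_max_of_lt_left (by linarith)
  exact (pow_pos this 2).ne'

lemma sum_sq_of_disjoint {ι : Type*} [Fintype ι] {v : ι → ℝ}
    (h : ∀ i j, i ≠ j → v i = 0 ∨ v j = 0) (a : ι → ℝ) :
    (∑ i, a i * v i) ^ 2 = ∑ i, a i ^ 2 * v i ^ 2 := by
  by_cases hv : ∀ i, v i = 0
  · simp [hv]
  · push Not at hv
    obtain ⟨i, hi⟩ := hv
    have h0 : ∀ j, j ≠ i → v j = 0 := fun j hj => (h j i hj).resolve_right hi
    rw [Finset.sum_eq_single i (fun j _ hj => by rw [h0 j hj, mul_zero]) (by simp),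
      Finset.sum_eq_single i (fun j _ hj => by rw [h0 j hj]; ring) (by simp)]
    ring

lemma exists_pos_lt_of_finite {ι : Type*} [Finite ι] {f : ι → ℝ} (h : ∀ i, 0 < f i) :
    ∃ δ, 0 < δ ∧ ∀ i, δ < f i := by
  have h1 : ∀ᶠ δ in 𝓝[>] (0 : ℝ), ∀ i, δ < f i :=
    eventually_all.2 fun i => (gt_mem_nhds (h i)).filter_mono nhdsWithin_le_nhds
  obtain ⟨δ, h2, h3⟩ := (h1.and self_mem_nhdsWithin).exists
  exact ⟨δ, h3, h2⟩

/-- Well separated points in an infinite subset of an interval. -/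
lemma exists_separated_points {S : Set ℝ} (hS : S.Infinite) (p q : ℝ) (K : ℕ) :
    ∃ (x : Fin K → ℝ) (r : ℝ), 0 < r ∧ (∀ i, x i ∈ S) ∧ (∀ i, r < |x i - p|) ∧
      (∀ i, 2 * r < |q - x i|) ∧ ∀ i j, i ≠ j → 2 * r < |x i - x j| := by
  obtain ⟨t, htS, htK⟩ := (hS.sdiff (Set.toFinite {p, q})).exists_subset_card_eq K
  let x : Fin K → ℝ := fun i => (t.equivFinOfCardEq htK).symm i
  have hxt : ∀ i, x i ∈ t := fun i => ((t.equivFinOfCardEq htK).symm i).2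
  have hinj : Function.Injective x := Subtype.val_injective.comp (Equiv.injective _)
  have hpos : ∀ k : (Fin K ⊕ Fin K) ⊕ {k : Fin K × Fin K // k.1 ≠ k.2},
      0 < Sum.elim (Sum.elim (fun i => |x i - p|) fun i => |q - x i| / 2)
        (fun k => |x k.1.1 - x k.1.2| / 2) k := by
    rintro ((i | i) | ⟨⟨i, j⟩, hij⟩)
    · exact abs_pos.2 (sub_ne_zero.2 fun h => (htS (hxt i)).2 (by simp [h]))
    · exact half_pos (abs_pos.2 (sub_ne_zero.2 fun h => (htS (hxt i)).2 (by simp [h])))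
    · exact half_pos (abs_pos.2 (sub_ne_zero.2 (hinj.ne hij)))
  obtain ⟨r, hr, h⟩ := exists_pos_lt_of_finite hpos
  refine ⟨x, r, hr, fun i => (htS (hxt i)).1, fun i => h (.inl (.inl i)), fun i => ?_,
    fun i j hij => ?_⟩
  · have := h (.inl (.inr i))
    simp only [Sum.elim_inl, Sum.elim_inr] at this
    linarith
  · have := h (.inr ⟨(i, j), hij⟩)
    simp only [Sum.elim_inr] at this
    linarith

lemma sum_scale (U : ℤ → ℝ) (n : ℕ) : ∑ k ∈ Finset.range n, U (k + 1) = scalePoint U n := by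
  induction n with
  | zero => simp [scalePoint_zero]
  | succ n ih => rw [Finset.sum_range_succ, ih, scalePoint_succ]

/-- The number of Dirichlet eigenvalues of the discrete strings in bounded intervals is eventually
at least any given number. -/
theorem exists_bound_card_le {U H : ℕ → ℤ → ℝ} (hU : ∀ n, 1 ≤ n → ∀ x, 0 < U n x)
    (hH : ∀ n, 1 ≤ n → ∀ x, 0 < H n x) {m : StieltjesFunction ℝ} [IsFiniteMeasure m.measure]
    {ℓ : ℝ} (hℓ : 0 < ℓ) (hlen : Tendsto (fun n : ℕ => scalePoint (U n) n) atTop (𝓝 ℓ))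
    (hweak : WeakTendsto (fun n => speedMeasure (U n) (H n) n) m.measure)
    (hinf : (growthSet m).Infinite) (K : ℕ) :
    ∃ C : ℝ, ∀ᶠ n in atTop, ∃ f : Fin K → ℕ → ℝ, (∀ i, f i 0 = 0) ∧ (∀ i, f i n = 0) ∧
      (∀ a : Fin K → ℝ, a ≠ 0 →
        0 < ∑ k ∈ Finset.range (n + 1), H n (k : ℤ) * (∑ i, a i * f i k) ^ 2) ∧
      ∀ a : Fin K → ℝ, ∑ k ∈ Finset.range n,
        (∑ i, a i * f i (k + 1) - ∑ i, a i * f i k) ^ 2 / U n (k + 1) ≤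
          C * ∑ k ∈ Finset.range (n + 1), H n (k : ℤ) * (∑ i, a i * f i k) ^ 2 := by
  -- Gaps above `2 * r` between centres make the hats disjoint. Distance above `r` from `0` makes
  -- them vanish there, and distance above `2 * r` from `ℓ` makes them vanish at the right endpoint
  -- once that is within `r` of `ℓ`.
  obtain ⟨x, r, hr, hxS, hx0, hxℓ, hsep⟩ := exists_separated_points hinf 0 ℓ K
  obtain ⟨δ, hδ, hδi⟩ := exists_pos_lt_of_finite fun i =>
    integral_hat_sq_pos (measure_ball_pos_of_mem_growthSet (hxS i) hr)
  -- The hats are 1-Lipschitz, so by Cauchy–Schwarz the energy is at most `K * (ℓ + 1) * ∑ i, a i ^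
  -- 2`; by disjointness the squared norm is at least `δ * ∑ i, a i ^ 2`.
  refine ⟨K * (ℓ + 1) / δ, ?_⟩
  have hlarge : ∀ᶠ n in atTop, ∀ i, δ < ∫ y, hat r (x i) y ^ 2 ∂speedMeasure (U n) (H n) n :=
    eventually_all.2 fun i => (hweak.integral ((continuous_hat r (x i)).pow 2)
      (norm_hat_sq_le r (x i))).eventually (lt_mem_nhds (hδi i))
  filter_upwards [hlarge, eventually_ge_atTop 1, Metric.tendsto_nhds.1 hlen r hr,
    hlen.eventually (gt_mem_nhds (lt_add_one ℓ))] with n hn hn1 hnr hnℓ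
  rw [Real.dist_eq] at hnr
  have hU := hU n hn1
  have hH := hH n hn1
  set X := scalePoint (U n)
  have hnorm : ∀ a : Fin K → ℝ,
      ∑ k ∈ Finset.range (n + 1), H n (k : ℤ) * (∑ i, a i * hat r (x i) (X k)) ^ 2 =
        ∑ i, a i ^ 2 * ∫ y, hat r (x i) y ^ 2 ∂speedMeasure (U n) (H n) n := by
    intro a
    simp_rw [integral_speedMeasure hH, Finset.mul_sum]
    rw [Finset.sum_comm]
    refine Finset.sum_congr rfl fun k _ => ?_
    rw [sum_sq_of_disjoint (v := fun i => hat r (x i) (X k)), Finset.mul_sum]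
    · refine Finset.sum_congr rfl fun i _ => ?_
      rw [smul_eq_mul]; ring
    · intro i j hij
      by_contra! hcon
      have h1 : |X k - x i| < r := not_le.1 fun h => hcon.1 (hat_eq_zero h)
      have h2 : |X k - x j| < r := not_le.1 fun h => hcon.2 (hat_eq_zero h)
      have h3 := abs_sub_le (x i) (X k) (x j)
      rw [abs_sub_comm (x i) (X k)] at h3
      linarith [hsep i j hij]
  have hlower : ∀ a : Fin K → ℝ, δ * ∑ i, a i ^ 2 ≤
      ∑ k ∈ Finset.range (n + 1), H n (k : ℤ) * (∑ i, a i * hat r (x i) (X k)) ^ 2 := by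
    intro a
    rw [hnorm, Finset.mul_sum]
    refine Finset.sum_le_sum fun i _ => ?_
    rw [mul_comm]
    exact mul_le_mul_of_nonneg_left (hn i).le (sq_nonneg _)
  refine ⟨fun i k => hat r (x i) (X k), fun i => hat_eq_zero ?_, fun i => hat_eq_zero ?_,
    fun a ha => lt_of_lt_of_le (mul_pos hδ ?_) (hlower a), fun a => ?_⟩
  · rw [show X 0 = 0 from scalePoint_zero _, abs_sub_comm]
    exact (hx0 i).le
  · have h3 := abs_sub_le ℓ (X n) (x i)
    rw [abs_sub_comm ℓ (X n)] at h3
    linarith [hxℓ i]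
  · obtain ⟨i, hi⟩ := Function.ne_iff.1 ha
    exact Finset.sum_pos' (fun _ _ => sq_nonneg _) ⟨i, Finset.mem_univ _, by
      have : a i ≠ 0 := hi
      positivity⟩
  · have hterm : ∀ k ∈ Finset.range n, (∑ i, a i * hat r (x i) (X (k + 1)) -
        ∑ i, a i * hat r (x i) (X k)) ^ 2 / U n (k + 1) ≤
        (∑ i, a i ^ 2) * K * U n (k + 1) := by
      intro k _
      rw [div_le_iff₀ (hU _), ← Finset.sum_sub_distrib]
      simp_rw [← mul_sub]
      refine (Finset.sum_mul_sq_le_sq_mul_sq _ _ _).trans ?_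
      have h1 : ∑ i : Fin K, (hat r (x i) (X (k + 1)) - hat r (x i) (X k)) ^ 2 ≤
          ∑ i : Fin K, U n (k + 1) ^ 2 := by
        refine Finset.sum_le_sum fun i _ => ?_
        have h2 := abs_hat_sub_le r (x i) (X (k + 1)) (X k)
        rw [show X (k + 1) - X k = U n (k + 1) by simp only [X, scalePoint_succ]; ring,
          abs_of_pos (hU _)] at h2
        rw [← sq_abs]
        gcongr
      rw [Finset.sum_const, Finset.card_univ, Fintype.card_fin, nsmul_eq_mul] at h1
      calc _ ≤ (∑ i, a i ^ 2) * (K * U n (k + 1) ^ 2) :=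
            mul_le_mul_of_nonneg_left h1 (Finset.sum_nonneg fun _ _ => sq_nonneg _)
        _ = _ := by ring
    calc _ ≤ ∑ k ∈ Finset.range n, (∑ i, a i ^ 2) * K * U n (k + 1) := Finset.sum_le_sum hterm
      _ = (∑ i, a i ^ 2) * K * X n := by rw [← Finset.mul_sum, sum_scale]
      _ ≤ (∑ i, a i ^ 2) * K * (ℓ + 1) := by
          have : 0 ≤ ∑ i, a i ^ 2 := Finset.sum_nonneg fun _ _ => sq_nonneg _
          gcongr
      _ = K * (ℓ + 1) / δ * (δ * ∑ i, a i ^ 2) := by field_simp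
      _ ≤ _ := mul_le_mul_of_nonneg_left (hlower a) (by positivity)

/-! ### Ordered lists of eigenvalues and extension of eigenfunctions by zero. -/

section Listing

/-- The `k`-th element of a finite set of reals, counted from `1` in increasing order. -/
noncomputable def nthElement (s : Finset ℝ) (k : ℕ) : ℝ :=
  if h : k - 1 < s.card then s.orderEmbOfFin rfl ⟨k - 1, h⟩ else 0

variable (s : Finset ℝ)

lemma nthElement_strictMonoOn : StrictMonoOn (nthElement s) (Set.Ico 1 (s.card + 1)) := by
  intro i hi j hj hij
  have h1 : i - 1 < s.card := by have := hi.1; have := hi.2; omega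
  have h2 : j - 1 < s.card := by have := hj.1; have := hj.2; omega
  rw [nthElement, nthElement, dif_pos h1, dif_pos h2]
  exact (s.orderEmbOfFin rfl).strictMono (by simp only [Fin.lt_def]; have := hi.1; omega)

lemma image_nthElement : nthElement s '' Set.Ico 1 (s.card + 1) = s := by
  rw [← Finset.range_orderEmbOfFin s rfl]
  ext t
  constructor
  · rintro ⟨k, hk, rfl⟩
    have h1 : k - 1 < s.card := by have := hk.1; have := hk.2; omega
    rw [nthElement, dif_pos h1]
    exact ⟨_, rfl⟩
  · rintro ⟨i, rfl⟩
    refine ⟨i + 1, ⟨by omega, by omega⟩, ?_⟩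
    have h1 : (i : ℕ) + 1 - 1 < s.card := by omega
    rw [nthElement, dif_pos h1]
    rfl

/-- If the `K`-th element exceeded `C`, only the first `K - 1` could be at most `C`. -/
lemma nthElement_le {K : ℕ} (hK : 1 ≤ K) {C : ℝ} (h : K ≤ (s.filter (· ≤ C)).card) :
    nthElement s K ≤ C := by
  classical
  by_contra! hlt
  have hKs : K < s.card + 1 := by
    have := Finset.card_filter_le s (· ≤ C)
    omega
  have hsub : s.filter (· ≤ C) ⊆ (Finset.Ico 1 K).image (nthElement s) := by
    intro t ht
    obtain ⟨hts, htC⟩ := Finset.mem_filter.1 ht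
    have : t ∈ nthElement s '' Set.Ico 1 (s.card + 1) := by rw [image_nthElement]; exact hts
    obtain ⟨k, hk, rfl⟩ := this
    refine Finset.mem_image.2 ⟨k, Finset.mem_Ico.2 ⟨hk.1, ?_⟩, rfl⟩
    by_contra! hKk
    have := (nthElement_strictMonoOn s).monotoneOn ⟨hK, hKs⟩ hk hKk
    linarith
  have := (Finset.card_le_card hsub).trans Finset.card_image_le
  rw [Nat.card_Ico] at this
  omega

end Listing

/-- The two cutoffs differ only between `ℓ` and `L n`, where `f` is small by continuity and `f ℓ =
0`. -/
lemma tendstoUniformlyOn_indicator {φ : ℕ → ℝ → ℂ} {f : ℝ → ℂ} (hf : Continuous f) {L : ℕ → ℝ}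
    {ℓ R : ℝ} (hL : Tendsto L atTop (𝓝 ℓ)) (hfℓ : f ℓ = 0)
    (h : TendstoUniformlyOn φ f atTop (Set.Icc 0 R)) :
    TendstoUniformlyOn (fun n => (Set.Icc 0 (L n)).indicator (φ n)) ((Set.Icc 0 ℓ).indicator f)
      atTop (Set.Icc 0 R) := by
  rw [Metric.tendstoUniformlyOn_iff] at h ⊢
  intro ε hε
  obtain ⟨δ, hδ, hδf⟩ := Metric.continuousAt_iff.1 (hf.continuousAt (x := ℓ)) (ε / 2) (by positivity)
  rw [hfℓ] at hδf
  filter_upwards [h (ε / 2) (by positivity), Metric.tendsto_nhds.1 hL δ hδ] with n hn hLn x hx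
  rw [Real.dist_eq, abs_lt] at hLn
  by_cases h1 : x ≤ ℓ <;> by_cases h2 : x ≤ L n
  · rw [Set.indicator_of_mem (Set.mem_Icc.2 ⟨hx.1, h1⟩), Set.indicator_of_mem (Set.mem_Icc.2 ⟨hx.1, h2⟩)]
    exact (hn x hx).trans (by linarith)
  · rw [Set.indicator_of_mem (Set.mem_Icc.2 ⟨hx.1, h1⟩), Set.indicator_of_notMem fun h => h2 h.2]
    exact (hδf (by rw [Real.dist_eq, abs_lt]; constructor <;> linarith)).trans (by linarith)
  · rw [Set.indicator_of_notMem fun h => h1 h.2, Set.indicator_of_mem (Set.mem_Icc.2 ⟨hx.1, h2⟩)]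
    have h3 := hδf (x := x) (by rw [Real.dist_eq, abs_lt]; constructor <;> linarith)
    have h4 := dist_triangle 0 (f x) (φ n x)
    have h5 := hn x hx
    rw [dist_comm] at h3
    linarith
  · rw [Set.indicator_of_notMem fun h => h1 h.2, Set.indicator_of_notMem fun h => h2 h.2, dist_self]
    exact hε

lemma isDirichletEigenvalue_iff (μ : Measure ℝ) [IsFiniteMeasure μ] {ℓ : ℝ} (hℓ : 0 < ℓ) (z : ℂ) :
    IsDirichletEigenvalue μ ℓ z ↔ stringSol μ z ℓ = 0 :=
  ⟨fun ⟨F, hF⟩ => ((isDirichletEigenfunction_iff μ hℓ z F).1 hF).1, fun h =>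
    ⟨stringSol μ z, (isDirichletEigenfunction_iff μ hℓ z _).2 ⟨h, 1, one_ne_zero, by simp⟩⟩⟩

lemma isSimpleDirichletEigenvalue_of_stringSol_eq_zero (μ : Measure ℝ) [IsFiniteMeasure μ] {ℓ : ℝ}
    (hℓ : 0 < ℓ) {z : ℂ} (h : stringSol μ z ℓ = 0) : IsSimpleDirichletEigenvalue μ ℓ z := by
  refine ⟨stringSol μ z, (isDirichletEigenfunction_iff μ hℓ z _).2 ⟨h, 1, one_ne_zero, by simp⟩,
    fun G hG => ?_⟩
  obtain ⟨-, b, -, hb⟩ := (isDirichletEigenfunction_iff μ hℓ z G).1 hG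
  exact ⟨b, hb⟩

/-- The complex zeros of the characteristic function are the given real ones. -/
lemma setOf_stringSol_eq_zero {μ : Measure ℝ} [IsFiniteMeasure μ] {ℓ : ℝ} (hℓ : 0 < ℓ)
    (hμ : μ (Set.Icc 0 ℓ)ᶜ = 0) {a : ℕ → ℝ} {I : Set ℕ}
    (h : {t | realSol μ t ℓ = 0} = a '' I) :
    {z | stringSol μ z ℓ = 0} = (fun k => (a k : ℂ)) '' I := by
  ext z
  constructor
  · intro hz
    obtain ⟨t, -, rfl⟩ := exists_pos_of_stringSol_eq_zero hℓ hμ hz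
    obtain ⟨k, hk, rfl⟩ := h.subset ((realSol_eq_zero_iff μ t ℓ).2 hz)
    exact ⟨k, hk, rfl⟩
  · rintro ⟨k, hk, rfl⟩
    exact (realSol_eq_zero_iff μ _ ℓ).1 (h.superset ⟨k, hk, rfl⟩)

lemma pos_of_realSol_eq_zero {μ : Measure ℝ} [IsFiniteMeasure μ] {ℓ t : ℝ} (hℓ : 0 < ℓ)
    (hμ : μ (Set.Icc 0 ℓ)ᶜ = 0) (ht : realSol μ t ℓ = 0) : 0 < t := by
  obtain ⟨s, hs, hts⟩ := exists_pos_of_stringSol_eq_zero hℓ hμ ((realSol_eq_zero_iff μ t ℓ).1 ht)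
  rwa [Complex.ofReal_inj.1 hts]

/-- Ordered lists of the Dirichlet eigenvalues of discrete strings converging to a string with
infinitely many points of increase: they are eventually bounded. -/
theorem exists_discrete_listing {U H : ℕ → ℤ → ℝ} (hU : ∀ n, 1 ≤ n → ∀ x, 0 < U n x)
    (hH : ∀ n, 1 ≤ n → ∀ x, 0 < H n x) {m : StieltjesFunction ℝ} [IsFiniteMeasure m.measure]
    {ℓ : ℝ} (hℓ : 0 < ℓ) (hlen : Tendsto (fun n : ℕ => scalePoint (U n) n) atTop (𝓝 ℓ))
    (hweak : WeakTendsto (fun n => speedMeasure (U n) (H n) n) m.measure)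
    (hinf : (growthSet m).Infinite) :
    ∃ a : ℕ → ℕ → ℝ, (∀ n, 1 ≤ n → StrictMonoOn (a n) (Set.Ico 1 n)) ∧
      (∀ n, 1 ≤ n → {t | realSol (speedMeasure (U n) (H n) n) t (scalePoint (U n) n) = 0} =
        a n '' Set.Ico 1 n) ∧
      ∀ k, 1 ≤ k → ∃ C, ∀ᶠ n in atTop, a n k ≤ C := by
  have hspec : ∀ n, 1 ≤ n → ∃ s : Finset ℝ, s.card + 1 = n ∧
      (∀ t, t ∈ s ↔ realSol (speedMeasure (U n) (H n) n) t (scalePoint (U n) n) = 0) ∧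
      ∀ (K : ℕ) (C : ℝ), (∃ f : Fin K → ℕ → ℝ, (∀ i, f i 0 = 0) ∧ (∀ i, f i n = 0) ∧
        (∀ a : Fin K → ℝ, a ≠ 0 →
          0 < ∑ k ∈ Finset.range (n + 1), H n (k : ℤ) * (∑ i, a i * f i k) ^ 2) ∧
        ∀ a : Fin K → ℝ, ∑ k ∈ Finset.range n,
          (∑ i, a i * f i (k + 1) - ∑ i, a i * f i k) ^ 2 / U n (k + 1) ≤
            C * ∑ k ∈ Finset.range (n + 1), H n (k : ℤ) * (∑ i, a i * f i k) ^ 2) →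
        K ≤ (s.filter (· ≤ C)).card := by
    intro n hn
    obtain ⟨N, rfl⟩ := Nat.exists_eq_add_of_le' hn
    obtain ⟨s, h1, h2, h3⟩ := exists_discrete_spectrum (N := N) (hU _ hn) (hH _ hn)
    exact ⟨s, by rw [h1], h2, fun K C ⟨f, f1, f2, f3, f4⟩ => h3 K C f f1 f2 f3 f4⟩
  choose! s hcard hs hsK using hspec
  refine ⟨fun n => nthElement (s n), fun n hn => ?_, fun n hn => ?_, fun k hk => ?_⟩
  · have := nthElement_strictMonoOn (s n)
    rwa [hcard n hn] at this
  · have := image_nthElement (s n)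
    rw [hcard n hn] at this
    rw [this]
    ext t
    exact (hs n hn t).symm
  · obtain ⟨C, hC⟩ := exists_bound_card_le hU hH hℓ hlen hweak hinf k
    refine ⟨C, ?_⟩
    filter_upwards [hC, eventually_ge_atTop 1] with n h1 h2
    exact nthElement_le (s n) hk (hsK n h2 k C h1)

/-! ### Assembly of the theorem. -/

theorem theorem2p1
    (c : ℕ → ℤ → ℤ → ℝ) (U H : ℕ → ℤ → ℝ)
    (hc : ∀ n : ℕ, 1 ≤ n → IsNearestNeighborRate (c n))
    (hUH : ∀ n : ℕ, 1 ≤ n → IsScaleSpeedPair (c n) (U n) (H n))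
    (m : StieltjesFunction ℝ) (hm : ∀ x : ℝ, x < 0 → m x = 0)
    (ℓ : ℝ) (hℓ : 0 < ℓ)
    (hlen : Tendsto (fun n : ℕ => scalePoint (U n) n) atTop (𝓝 ℓ))
    (hweak : ∀ f : BoundedContinuousFunction ℝ ℝ,
      Tendsto (fun n : ℕ => ∫ x, f x ∂(speedMeasure (U n) (H n) n)) atTop
        (𝓝 (∫ x, f x ∂m.measure)))
    (hinf : IsGLB (growthSet m) 0) (hsup : IsLUB (growthSet m) ℓ)
    (hdelta : ¬ ∃ (s : Finset ℝ) (w : ℝ → NNReal),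
      m.measure = ∑ x ∈ s, w x • Measure.dirac x) :
    ∃ (lam : ℕ → ℝ) (lamn : ℕ → ℕ → ℝ),
      -- the eigenvalues of `-D_m D_x`, listed as `lam 1 < lam 2 < ⋯`, are positive and simple
      (StrictMonoOn lam (Set.Ici 1) ∧
        {z : ℂ | IsDirichletEigenvalue m.measure ℓ z} =
          (fun k : ℕ => (lam k : ℂ)) '' Set.Ici 1 ∧
        ∀ k : ℕ, 1 ≤ k →
          0 < lam k ∧ IsSimpleDirichletEigenvalue m.measure ℓ (lam k : ℂ)) ∧
      -- the eigenvalues of `-𝕃_n`, listed as `lamn n 1 < ⋯ < lamn n (n - 1)`, are positive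
      -- and simple
      (∀ n : ℕ, 1 ≤ n →
        StrictMonoOn (lamn n) (Set.Ico 1 n) ∧
        {z : ℂ | Module.End.HasEigenvalue (-walkGenerator (c n) n) z} =
          (fun k : ℕ => (lamn n k : ℂ)) '' Set.Ico 1 n ∧
        ∀ k ∈ Set.Ico 1 n,
          0 < lamn n k ∧
          Module.finrank ℂ
            (Module.End.eigenspace (-walkGenerator (c n) n) (lamn n k : ℂ)) = 1) ∧
      -- convergence of the eigenvalues
      (∀ k : ℕ, 1 ≤ k → Tendsto (fun n : ℕ => lamn n k) atTop (𝓝 (lam k))) ∧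
      -- convergence of the eigenfunctions, extended by zero
      (∀ k : ℕ, 1 ≤ k → ∀ F : ℝ → ℂ,
        IsDirichletEigenfunction m.measure ℓ (lam k : ℂ) F →
        ∃ Fn : ℕ → ℝ → ℂ,
          (∀ n : ℕ, k < n →
            IsDirichletEigenfunction (speedMeasure (U n) (H n) n) (scalePoint (U n) n)
              (lamn n k : ℂ) (Fn n)) ∧
          TendstoUniformlyOn
            (fun n : ℕ => (Set.Icc 0 (scalePoint (U n) n)).indicator (Fn n))
            ((Set.Icc 0 ℓ).indicator F) atTop (Set.Icc 0 (ℓ + 1))) := by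
  have hU : ∀ n, 1 ≤ n → ∀ x, 0 < U n x := fun n hn => (hUH n hn).1
  have hH : ∀ n, 1 ≤ n → ∀ x, 0 < H n x := fun n hn => (hUH n hn).2.1
  have hμ := measure_compl_Icc hm hsup.1
  have hfin := isFiniteMeasure_of_compl_Icc hμ
  have hw : WeakTendsto (fun n => speedMeasure (U n) (H n) n) m.measure := hweak
  obtain ⟨a, hmono, hzero, hbdd⟩ := exists_discrete_listing hU hH hℓ hlen hw
    (infinite_growthSet hm hdelta)
  have hLpos : ∀ n, 1 ≤ n → 0 < scalePoint (U n) n := fun n hn => scalePoint_pos (hU n hn) hn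
  have hμn : ∀ n, 1 ≤ n → speedMeasure (U n) (H n) n (Set.Icc 0 (scalePoint (U n) n))ᶜ = 0 :=
    fun n hn => speedMeasure_compl (hU n hn) (H n) n le_rfl
  have hμ' : m.measure (Set.Icc 0 (ℓ + 1))ᶜ = 0 := measure_mono_null
    (Set.compl_subset_compl.2 (Set.Icc_subset_Icc_right (by linarith))) hμ
  have hμn' : ∀ᶠ n in atTop, speedMeasure (U n) (H n) n (Set.Icc 0 (ℓ + 1))ᶜ = 0 := by
    filter_upwards [eventually_ge_atTop 1, hlen.eventually (ge_mem_nhds (lt_add_one ℓ))] with n h1 h2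
    exact speedMeasure_compl (hU n h1) (H n) n h2
  have hzero' : ∀ n, ∀ k ∈ Set.Ico 1 n,
      realSol (speedMeasure (U n) (H n) n) (a n k) (scalePoint (U n) n) = 0 := fun n k hk =>
    (hzero n (by have := hk.1; have := hk.2; omega)).superset ⟨k, hk, rfl⟩
  have hpos : ∀ n, 1 ≤ n → ∀ k ∈ Set.Ico 1 n, 0 < a n k := fun n hn k hk =>
    pos_of_realSol_eq_zero (hLpos n hn) (hμn n hn) (hzero' n k hk)
  have hcluster : ∀ k, 1 ≤ k → ∀ φ : ℕ → ℕ, StrictMono φ → ∀ w,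
      Tendsto (fun i => a (φ i) k) atTop (𝓝 w) → w ∈ {t | realSol m.measure t ℓ = 0} := by
    intro k hk φ hφ w hlim
    refine tendsto_nhds_unique_of_eventuallyEq (tendsto_realSol hw hφ.tendsto_atTop hlim hℓ
      (hlen.comp hφ.tendsto_atTop)) tendsto_const_nhds ?_
    filter_upwards [hφ.tendsto_atTop.eventually_gt_atTop k] with i hi
    exact hzero' (φ i) k ⟨hk, hi⟩
  obtain ⟨lam, hlam, hZ, hlim⟩ := exists_limit_enumeration (Z := {t | realSol m.measure t ℓ = 0})
    hmono hpos hbdd hcluster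
    (fun z hz ε hε => by
      filter_upwards [eventually_exists_realSol_eq_zero hw hℓ hμ hlen hz hε,
        eventually_ge_atTop 1] with n ⟨t, ht, h0⟩ hn
      obtain ⟨k, hk, rfl⟩ := (hzero n hn).subset h0
      exact ⟨k, hk, ht⟩)
    -- Consecutive discrete eigenfunctions are orthogonal; if both eigenvalues tended to `w`, the
    -- limit would give `∫ φ_w² = 0`, contradicting positivity.
    (fun k hk φ hφ w h1 h2 => by
      refine (integral_realSol_mul_self_pos hℓ hμ (hcluster k hk φ hφ w h1)).ne'
        (tendsto_nhds_unique_of_eventuallyEq (tendsto_integral_realSol_mul hw (by positivity)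
          hμn' hμ' hφ.tendsto_atTop h1 h2) tendsto_const_nhds ?_)
      filter_upwards [hφ.tendsto_atTop.eventually_gt_atTop (k + 1)] with i hi
      have m1 : k ∈ Set.Ico 1 (φ i) := ⟨hk, by omega⟩
      have m2 : k + 1 ∈ Set.Ico 1 (φ i) := ⟨by omega, hi⟩
      exact integral_realSol_mul_eq_zero (hLpos _ (by omega)) (hμn _ (by omega))
        (hmono _ (by omega) m1 m2 (Nat.lt_succ_self k)).ne (hzero' _ _ m1) (hzero' _ _ m2))
    (fun z hz => pos_of_realSol_eq_zero hℓ hμ hz) (eventually_realSol_ne_zero hℓ hμ)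
  have hlam0 : ∀ k, 1 ≤ k → realSol m.measure (lam k) ℓ = 0 := fun k hk =>
    hZ.superset ⟨k, hk, rfl⟩
  refine ⟨lam, a, ⟨hlam, ?_, fun k hk => ⟨pos_of_realSol_eq_zero hℓ hμ (hlam0 k hk),
    isSimpleDirichletEigenvalue_of_stringSol_eq_zero _ hℓ
      ((realSol_eq_zero_iff _ _ _).1 (hlam0 k hk))⟩⟩,
    fun n hn => ⟨hmono n hn, ?_, fun k hk => ⟨hpos n hn k hk,
      finrank_eigenspace_walkGenerator (hUH n hn) hn
        ((realSol_eq_zero_iff _ _ _).1 (hzero' n k hk))⟩⟩, hlim, fun k hk F hF => ?_⟩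
  · simp_rw [isDirichletEigenvalue_iff m.measure hℓ]
    exact setOf_stringSol_eq_zero hℓ hμ hZ
  · simp_rw [hasEigenvalue_walkGenerator_iff (hUH n hn) hn]
    exact setOf_stringSol_eq_zero (hLpos n hn) (hμn n hn) (hzero n hn)
  · obtain ⟨h0, b, hb, hFb⟩ := (isDirichletEigenfunction_iff m.measure hℓ _ F).1 hF
    -- The approximating eigenfunctions share the initial slope `b` of `F`, which fixes the
    -- normalization for every `n`.
    refine ⟨fun n x => b * stringSol (speedMeasure (U n) (H n) n) (a n k) x, fun n hn => ?_, ?_⟩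
    · exact (isDirichletEigenfunction_iff _ (hLpos n (by omega)) _ _).2
        ⟨(realSol_eq_zero_iff _ _ _).1 (hzero' n k ⟨hk, hn⟩), b, hb, fun _ _ => rfl⟩
    · have hind : (Set.Icc 0 ℓ).indicator F =
          (Set.Icc 0 ℓ).indicator fun x => b * stringSol m.measure (lam k) x :=
        Set.indicator_congr hFb
      rw [hind]
      refine tendstoUniformlyOn_indicator (continuous_const.mul (continuous_stringSol _ _)) hlen
        (by simp [h0]) ?_
      exact (ContinuousLinearMap.mul ℂ ℂ b).uniformContinuous.comp_tendstoUniformlyOn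
        (hw.stringSol (by positivity) tendsto_id
          ((Complex.continuous_ofReal.tendsto _).comp (hlim k hk)))
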